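/- Let $0<\epsilon'<1/2$ and $\delta\ge\epsilon'$. A nonempty finite (multi)set $S\subset\mathbb{R}^d$ is called $(\epsilon',\delta)$-stable with respect to a probability distribution $X$ on $\mathbb{R}^d$ with mean $\mu_X$ if for every unit vector $v\in\mathbb{R}^d$ and every $S'\subseteq S$ with $|S'|\ge(1-\epsilon')|S|$ we have $$\Big|\frac1{|S'|}\sum_{x\in S'}v\cdot(x-\mu_X)\Big|\le\delta\qquad\text{and}\qquad\Big|\frac1{|S'|}\sum_{x\in S'}\big(v\cdot(x-\mu_X)\big)^2-1\Big|\le\frac{\delta^2}{\epsilon'}.$$ A (multi)set $T$ is an $\epsilon$-corrupted version of $S$ if it is obtained from $S$ by removing at most $\epsilon|S|$ of its points and replacing them by the same number of arbitrary points of $\mathbb{R}^d$. Theorem. There are a universal constant $C$ and a single deterministic algorithm in the real-number model of computation (real RAM: exact arithmetic operations and comparisons of real numbers at unit cost, rational program constants) which, given $\epsilon$ and any $n$ points of $\mathbb{R}^d$, halts after a number of steps bounded by a polynomial in $n$ and $d$, and which has the following property. Whenever $S$ is a nonempty $(3\epsilon,\delta)$-stable (multi)set with respect to a distribution $X$ on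 $\mathbb{R}^d$ with mean $\mu_X$, and $T$ is an $\epsilon$-corrupted version of $S$, the algorithm, given $\epsilon$ and the points of $T$ listed in any order, outputs a vector $\widehat\mu\in\mathbb{R}^d$ with $\|\widehat\mu-\mu_X\|_2\le C\,\delta$. -/

import Mathlib

open MeasureTheory

/-! ## A real-number random access machine, programmed in a small imperative language

Real numbers are stored exactly; the four arithmetic operations and the comparison of two reals
are primitive steps. There is no rounding, no integer part and no root. A program is a finite
piece of text whose only constants are natural and rational numbers; one program serves all
input sizes. -/

namespace RealRAM

/-- A memory state: index registers holding natural numbers, and two-dimensional arrays of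
real numbers, `real a i j` being the entry `(i, j)` of the array `a`. -/
structure Store where
  index : ℕ → ℕ
  real : ℕ → ℕ → ℕ → ℝ

/-- Index expressions (`sub` is truncated subtraction). -/
inductive IndexExpr where
  | const (c : ℕ)
  | reg (k : ℕ)
  | add (e f : IndexExpr)
  | sub (e f : IndexExpr)

/-- Value of an index expression. -/
def IndexExpr.eval (s : Store) : IndexExpr → ℕ
  | const c => c
  | reg k => s.index k
  | add e f => e.eval s + f.eval s
  | sub e f => e.eval s - f.eval s

/-- Real expressions. Array names are part of the program text, array positions are computed. -/
inductive RealExpr where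
  | const (q : ℚ)
  | ofIndex (e : IndexExpr)
  | entry (a : ℕ) (i j : IndexExpr)
  | add (e f : RealExpr)
  | sub (e f : RealExpr)
  | mul (e f : RealExpr)
  | div (e f : RealExpr)

/-- Value of a real expression. Division by zero returns zero; since a program can test a
divisor first, this convention adds no power. -/
noncomputable def RealExpr.eval (s : Store) : RealExpr → ℝ
  | const q => (q : ℝ)
  | ofIndex e => (e.eval s : ℝ)
  | entry a i j => s.real a (i.eval s) (j.eval s)
  | add e f => e.eval s + f.eval s
  | sub e f => e.eval s - f.eval s
  | mul e f => e.eval s * f.eval s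
  | div e f => e.eval s / f.eval s

/-- Tests: comparison of two indices or of two reals. -/
inductive Test where
  | indexLe (e f : IndexExpr)
  | realLe (e f : RealExpr)

/-- Truth value of a test. -/
def Test.Holds (s : Store) : Test → Prop
  | indexLe e f => e.eval s ≤ f.eval s
  | realLe e f => e.eval s ≤ f.eval s

/-- Programs. -/
inductive Program where
  | skip
  | setIndex (k : ℕ) (e : IndexExpr)
  | setReal (a : ℕ) (i j : IndexExpr) (e : RealExpr)
  | seq (P Q : Program)
  | branch (b : Test) (P Q : Program)
  | loop (b : Test) (P : Program)

/-- Assignment to an index register. -/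
def Store.setIndex (s : Store) (k v : ℕ) : Store :=
  { s with index := Function.update s.index k v }

/-- Assignment to an array entry. -/
noncomputable def Store.setReal (s : Store) (a i j : ℕ) (v : ℝ) : Store :=
  { s with real := fun a' i' j' => if a' = a ∧ i' = i ∧ j' = j then v else s.real a' i' j' }

/-- `Exec P s t s'`: the program `P`, started in the state `s`, halts in the state `s'` after
exactly `t` steps. Every assignment and every evaluation of a test counts as one step. (The
expressions in them are part of the program text, so one step consists of a number of
machine operations that is bounded by a constant depending on the program only.) -/
inductive Exec : Program → Store → ℕ → Store → Prop
  | skip (s : Store) : Exec .skip s 1 s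
  | setIndex (s : Store) (k : ℕ) (e : IndexExpr) :
      Exec (.setIndex k e) s 1 (s.setIndex k (e.eval s))
  | setReal (s : Store) (a : ℕ) (i j : IndexExpr) (e : RealExpr) :
      Exec (.setReal a i j e) s 1 (s.setReal a (i.eval s) (j.eval s) (e.eval s))
  | seq {P Q : Program} {s s' s'' : Store} {t t' : ℕ} :
      Exec P s t s' → Exec Q s' t' s'' → Exec (.seq P Q) s (t + t') s''
  | branch_true {b : Test} {P Q : Program} {s s' : Store} {t : ℕ} :
      b.Holds s → Exec P s t s' → Exec (.branch b P Q) s (t + 1) s'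
  | branch_false {b : Test} {P Q : Program} {s s' : Store} {t : ℕ} :
      ¬ b.Holds s → Exec Q s t s' → Exec (.branch b P Q) s (t + 1) s'
  | loop_true {b : Test} {P : Program} {s s' s'' : Store} {t t' : ℕ} :
      b.Holds s → Exec P s t s' → Exec (.loop b P) s' t' s'' →
        Exec (.loop b P) s (t + t' + 1) s''
  | loop_false {b : Test} {P : Program} {s : Store} :
      ¬ b.Holds s → Exec (.loop b P) s 1 s

/-- Initial state for the input consisting of a real number `ε` and of `n` points in `ℝᵈ`:
register `0` holds `d`, register `1` holds `n`, array `0` holds `ε` at position `(0, 0)`,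
array `1` holds the `j`-th coordinate of the `i`-th point at position `(i, j)`; everything
else is zero. -/
noncomputable def input {d n : ℕ} (ε : ℝ) (y : Fin n → EuclideanSpace ℝ (Fin d)) : Store where
  index := fun k => if k = 0 then d else if k = 1 then n else 0
  real := fun a i j =>
    if a = 0 then (if i = 0 ∧ j = 0 then ε else 0)
    else if a = 1 then
      (if hi : i < n then (if hj : j < d then y ⟨i, hi⟩ ⟨j, hj⟩ else 0) else 0)
    else 0

/-- The vector in `ℝᵈ` returned in a final state: the first `d` entries of row `0` of
array `2`. -/
noncomputable def output (d : ℕ) (s : Store) : EuclideanSpace ℝ (Fin d) :=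
  WithLp.toLp 2 fun j : Fin d => s.real 2 0 j

end RealRAM

/-! ## Stability and corruption

A finite set of `n` points (samples) is given as a family indexed by `Fin n`; repeated points are
allowed, and an actual set is the case of an injective family. -/

/-- The mean `μ_X` of a distribution `X` on `ℝᵈ`. -/
noncomputable def distMean {d : ℕ} (X : Measure (EuclideanSpace ℝ (Fin d))) :
    EuclideanSpace ℝ (Fin d) :=
  ∫ z, z ∂X

/-- `(ε, δ)`-stability of a finite set of points with respect to a distribution `X`. -/
structure IsStable {d n : ℕ} (ε δ : ℝ) (X : Measure (EuclideanSpace ℝ (Fin d)))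
    (x : Fin n → EuclideanSpace ℝ (Fin d)) : Prop where
  eps_pos : 0 < ε
  eps_lt_half : ε < 1 / 2
  eps_le_delta : ε ≤ δ
  mean_close : ∀ v : EuclideanSpace ℝ (Fin d), ‖v‖ = 1 →
    ∀ S' : Finset (Fin n), (1 - ε) * (n : ℝ) ≤ (S'.card : ℝ) →
      |(1 / (S'.card : ℝ)) * ∑ i ∈ S', inner ℝ v (x i - distMean X)| ≤ δ
  variance_close : ∀ v : EuclideanSpace ℝ (Fin d), ‖v‖ = 1 →
    ∀ S' : Finset (Fin n), (1 - ε) * (n : ℝ) ≤ (S'.card : ℝ) →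
      |(1 / (S'.card : ℝ)) * ∑ i ∈ S', (inner ℝ v (x i - distMean X)) ^ 2 - 1| ≤ δ ^ 2 / ε

open Classical in
/-- `y` is an `ε`-corrupted version of `x`: after listing the points of `x` in a suitable order,
at most an `ε`-fraction of them has been replaced, by arbitrary points. -/
def IsCorruption {d n : ℕ} (ε : ℝ) (x y : Fin n → EuclideanSpace ℝ (Fin d)) : Prop :=
  ∃ σ : Equiv.Perm (Fin n),
    ((Finset.univ.filter fun i : Fin n => y i ≠ x (σ i)).card : ℝ) ≤ ε * n

/-! The algorithm is a weighted filter. Put D = δ²/(3ε). The bad points carry weight at most εn, so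
by Cauchy–Schwarz they can shift the weighted mean in a direction only by having a large second
moment there, while stability pins down the second moment of the good points even after a little
weight is removed. Hence total weight at least (1 - 2ε)n together with scatter at most (1 + O(D))n
in every direction forces a mean error O(δ) (`Clean.mean_sq_le`).

If the scatter along the rows of a matrix V is too large, the scores ‖V(y_i - mean)‖² above a
suitable threshold have a larger weighted sum over bad points than over good ones
(`FilterState.sum_good_lt_sum_bad`). Multiplying these weights by 1 - score/maximum thus removes
more bad weight than good weight and annihilates one more point.

The algorithm does not know δ and cannot see when to stop, so it always makes n rounds. This is
harmless: scatter only decreases with the weights (`spread_mono`), so small scatter persists, and a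
test in each round guards the total weight. If small scatter were never reached, all n points would
be annihilated, contradicting that guard (`RoundInvariant.norm_sub_le`).

Eigenvectors are not computable by arithmetic alone. Instead V = M^(dn) for the scatter matrix M:
log-convexity of moments shows that tr M^(2dn+1) / tr M^(2dn) bounds the quadratic form of M up to a
factor 1 + 1/n (`Matrix.PosSemidef.quad_le_of_trace_pow`).

Everything is built from sums, maxima, case distinctions and counted loops, which are translated
into programs once and for all (`Evaluable`, `Implementable`); halting in polynomial time is
therefore unconditional. -/

namespace RealRAM

/-! ### Counted loops -/

/-- Contents of the real arrays of a store. -/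
abbrev Arrays := ℕ → ℕ → ℕ → ℝ

/-- The ranges over which loops run: a single value, the dimension, or the number of points. -/
inductive Bound where
  | one
  | dim
  | size

/-- A bound as an index expression. -/
def Bound.expr : Bound → IndexExpr
  | one => .const 1
  | dim => .reg 0
  | size => .reg 1

/-- The value of a bound for `n` points in dimension `d`. -/
def Bound.val (d n : ℕ) : Bound → ℕ
  | one => 1
  | dim => d
  | size => n

theorem Bound.eval_expr (b : Bound) (s : Store) :
    b.expr.eval s = b.val (s.index 0) (s.index 1) := by
  cases b <;> rfl

theorem Bound.val_le (b : Bound) (d n : ℕ) : b.val d n ≤ d + n + 1 := by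
  cases b <;> simp only [Bound.val] <;> omega

@[simp] theorem Store.setIndex_index (s : Store) (k v j : ℕ) :
    (s.setIndex k v).index j = if j = k then v else s.index j := by
  simp [Store.setIndex, Function.update_apply]

@[simp] theorem Store.setIndex_real (s : Store) (k v : ℕ) : (s.setIndex k v).real = s.real := rfl

@[simp] theorem Store.setReal_index (s : Store) (a i j : ℕ) (v : ℝ) :
    (s.setReal a i j v).index = s.index := rfl

theorem Store.setReal_real (s : Store) (a i j : ℕ) (v : ℝ) (a' i' j' : ℕ) :
    (s.setReal a i j v).real a' i' j' =
      if a' = a ∧ i' = i ∧ j' = j then v else s.real a' i' j' := rfl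

theorem Store.setReal_real_of_ne (s : Store) {a a' : ℕ} (h : a' ≠ a) (i j : ℕ) (v : ℝ) :
    (s.setReal a i j v).real a' = s.real a' := by
  funext i' j'
  simp [Store.setReal_real, h]

/-- `for k < b do P`. -/
def Program.count (k : ℕ) (b : Bound) (P : Program) : Program :=
  .seq (.setIndex k (.const 0))
    (.loop (.indexLe (.add (.reg k) (.const 1)) b.expr)
      (.seq P (.setIndex k (.add (.reg k) (.const 1)))))

/-- Each pass pays 2 extra steps for test and increment; initialization and the last, failing test
pay the final 2. The invariant at `x + 1` is required after the increment, so that it may mention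
the counter. -/
theorem exec_count {k : ℕ} {b : Bound} {P : Program} {N B : ℕ} (I : ℕ → Store → Prop)
    (hI : ∀ x s, I x s → s.index k = x ∧ b.val (s.index 0) (s.index 1) = N)
    (hstep : ∀ x s, x < N → I x s → ∃ t s', Exec P s t s' ∧ t ≤ B ∧ s'.index k = x ∧
      I (x + 1) (s'.setIndex k (x + 1)))
    (s : Store) (h0 : I 0 (s.setIndex k 0)) :
    ∃ t s', Exec (Program.count k b P) s t s' ∧ t ≤ N * (B + 2) + 2 ∧ I N s' := by
  have main : ∀ m x s, x + m = N → I x s →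
      ∃ t s', Exec (.loop (.indexLe (.add (.reg k) (.const 1)) b.expr)
        (.seq P (.setIndex k (.add (.reg k) (.const 1))))) s t s' ∧ t ≤ m * (B + 2) + 1 ∧
        I N s' := by
    intro m
    induction m with
    | zero =>
      intro x s hx h
      obtain ⟨h1, h2⟩ := hI x s h
      refine ⟨1, s, Exec.loop_false ?_, by omega, by rwa [← hx]⟩
      simp only [Test.Holds, Bound.eval_expr, IndexExpr.eval, h1, h2]
      omega
    | succ m ih =>
      intro x s hx h
      obtain ⟨h1, h2⟩ := hI x s h
      obtain ⟨t, s', he, ht, hk, hI'⟩ := hstep x s (by omega) h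
      obtain ⟨t', s'', he', ht', hI''⟩ := ih (x + 1) _ (by omega) hI'
      have hset := Exec.setIndex s' k (.add (.reg k) (.const 1))
      have hev : (IndexExpr.add (.reg k) (.const 1)).eval s' = x + 1 := by
        simp [IndexExpr.eval, hk]
      rw [hev] at hset
      refine ⟨_, s'', Exec.loop_true ?_ (Exec.seq he hset) he', ?_, hI''⟩
      · simp only [Test.Holds, Bound.eval_expr, IndexExpr.eval, h1, h2]
        omega
      · have : (m + 1) * (B + 2) = m * (B + 2) + (B + 2) := by ring
        omega
  obtain ⟨t, s', he, ht, h⟩ := main N 0 _ (by omega) h0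
  have h1 := Exec.setIndex s k (.const 0)
  exact ⟨_, s', Exec.seq h1 he, by omega, h⟩

/-! ### Real-valued terms and their evaluation by programs -/

/-- Agreement of two stores on the data that a term with variables below `L` may depend on: the
registers `0, 1, 2` and `6, …, L - 1`, and all arrays but the scratch arrays `3` and `4`. -/
structure Agree (L : ℕ) (s s' : Store) : Prop where
  index : ∀ k < L, k < 3 ∨ 6 ≤ k → s.index k = s'.index k
  real : ∀ a, a ≠ 3 → a ≠ 4 → s.real a = s'.real a

/-- `s'` differs from `s` at most in the registers from `L` on and, among the arrays, in array `3`,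
where the entries `(i, 0)` with `i < l` are kept. -/
structure Frame (L l : ℕ) (s s' : Store) : Prop where
  index : ∀ k < L, s'.index k = s.index k
  real : ∀ a, a ≠ 3 → s'.real a = s.real a
  scratch : ∀ i < l, s'.real 3 i 0 = s.real 3 i 0

theorem Frame.agree {L l : ℕ} {s s' : Store} (h : Frame L l s s') : Agree L s' s :=
  ⟨fun k hk _ => h.index k hk, fun a ha _ => h.real a ha⟩

theorem Frame.trans {L l : ℕ} {s s' s'' : Store} (h : Frame L l s s') (h' : Frame L l s' s'') :
    Frame L l s s'' :=
  ⟨fun k hk => (h'.index k hk).trans (h.index k hk),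
   fun a ha => (h'.real a ha).trans (h.real a ha),
   fun i hi => (h'.scratch i hi).trans (h.scratch i hi)⟩

theorem Frame.mono {L l L' l' : ℕ} {s s' : Store} (h : Frame L l s s') (hL : L' ≤ L) (hl : l' ≤ l) :
    Frame L' l' s s' :=
  ⟨fun k hk => h.index k (by omega), h.real, fun i hi => h.scratch i (by omega)⟩

theorem Frame.setReal {L l : ℕ} (s : Store) (i j : ℕ) (v : ℝ) (hi : l ≤ i) :
    Frame L l s (s.setReal 3 i j v) :=
  ⟨fun _ _ => rfl, fun _ ha => s.setReal_real_of_ne ha _ _ _, fun i' hi' => by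
    rw [Store.setReal_real, if_neg]
    omega⟩

theorem Frame.setIndex {L l : ℕ} (s : Store) (k v : ℕ) (hk : L ≤ k) :
    Frame L l s (s.setIndex k v) :=
  ⟨fun j hj => by simp; omega, fun _ _ => rfl, fun _ _ => rfl⟩

/-- A real-valued function of the store is evaluable with variables below `L` if it depends only
on the data of `Agree L` and, for each `l`, some program computes it into entry `(l, 0)` of
the scratch array in polynomially many steps, within the limits of `Frame L l`. -/
structure Evaluable (L : ℕ) (F : Store → ℝ) : Prop where
  congr : ∀ s s', Agree L s s' → F s = F s'
  exec : ∀ l, ∃ (P : Program) (p : Polynomial ℕ), ∀ s, ∃ t s', Exec P s t s' ∧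
    t ≤ p.eval (s.index 0 + s.index 1) ∧ s'.real 3 l 0 = F s ∧ Frame L l s s'

theorem Evaluable.of_expr {L : ℕ} {F : Store → ℝ} (e : RealExpr)
    (hcongr : ∀ s s', Agree L s s' → F s = F s') (he : ∀ s, e.eval s = F s) : Evaluable L F where
  congr := hcongr
  exec l := by
    refine ⟨.setReal 3 (.const l) (.const 0) e, 1, fun s =>
      ⟨1, _, Exec.setReal s 3 _ _ e, by simp, ?_, Frame.setReal _ _ _ _ ?_⟩⟩
    · simp [Store.setReal_real, IndexExpr.eval, he]
    · simp [IndexExpr.eval]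

theorem Evaluable.const (L : ℕ) (q : ℚ) : Evaluable L fun _ => (q : ℝ) :=
  .of_expr (.const q) (fun _ _ _ => rfl) (fun _ => rfl)

theorem Evaluable.ofIndex {L k : ℕ} (hk : k < L) (hk' : k < 3 ∨ 6 ≤ k) :
    Evaluable L fun s => (s.index k : ℝ) :=
  .of_expr (.ofIndex (.reg k)) (fun _ _ h => by rw [h.index k hk hk']) (fun _ => rfl)

theorem Evaluable.entry {L a i j : ℕ} (h3 : a ≠ 3) (h4 : a ≠ 4) (hi : i < L) (hi' : i < 3 ∨ 6 ≤ i)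
    (hj : j < L) (hj' : j < 3 ∨ 6 ≤ j) : Evaluable L fun s => s.real a (s.index i) (s.index j) :=
  .of_expr (.entry a (.reg i) (.reg j))
    (fun _ _ h => by rw [h.index i hi hi', h.index j hj hj', h.real a h3 h4]) (fun _ => rfl)

/-- A binary operation that a program performs on consecutive scratch entries in a few steps. -/
def IsPrimitive (op : ℝ → ℝ → ℝ) : Prop :=
  ∀ l, ∃ Q, ∀ s : Store, ∃ t, Exec Q s t
    (s.setReal 3 l 0 (op (s.real 3 l 0) (s.real 3 (l + 1) 0))) ∧ t ≤ 2

theorem IsPrimitive.of_expr {op : ℝ → ℝ → ℝ} (e : RealExpr → RealExpr → RealExpr)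
    (h : ∀ s x y, (e x y).eval s = op (x.eval s) (y.eval s)) : IsPrimitive op := fun l => by
  refine ⟨.setReal 3 (.const l) (.const 0)
    (e (.entry 3 (.const l) (.const 0)) (.entry 3 (.const (l + 1)) (.const 0))), fun s =>
      ⟨1, ?_, by omega⟩⟩
  have := Exec.setReal s 3 (.const l) (.const 0)
    (e (.entry 3 (.const l) (.const 0)) (.entry 3 (.const (l + 1)) (.const 0)))
  rwa [h] at this

theorem isPrimitive_add : IsPrimitive (· + ·) := .of_expr .add fun _ _ _ => rfl
theorem isPrimitive_sub : IsPrimitive (· - ·) := .of_expr .sub fun _ _ _ => rfl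
theorem isPrimitive_mul : IsPrimitive (· * ·) := .of_expr .mul fun _ _ _ => rfl
theorem isPrimitive_div : IsPrimitive (· / ·) := .of_expr .div fun _ _ _ => rfl

/-- Operations that branch on the comparison of their arguments. -/
theorem IsPrimitive.of_branch {op : ℝ → ℝ → ℝ} (e e' : RealExpr → RealExpr → RealExpr)
    (h : ∀ s x y, x.eval s ≤ y.eval s → (e x y).eval s = op (x.eval s) (y.eval s))
    (h' : ∀ s x y, ¬ x.eval s ≤ y.eval s → (e' x y).eval s = op (x.eval s) (y.eval s)) :
    IsPrimitive op := fun l => by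
  set x : RealExpr := .entry 3 (.const l) (.const 0)
  set y : RealExpr := .entry 3 (.const (l + 1)) (.const 0)
  refine ⟨.branch (.realLe x y) (.setReal 3 (.const l) (.const 0) (e x y))
    (.setReal 3 (.const l) (.const 0) (e' x y)), fun s => ⟨2, ?_, le_rfl⟩⟩
  by_cases hxy : x.eval s ≤ y.eval s
  · have := Exec.setReal s 3 (.const l) (.const 0) (e x y)
    rw [h _ _ _ hxy] at this
    exact Exec.branch_true hxy this
  · have := Exec.setReal s 3 (.const l) (.const 0) (e' x y)
    rw [h' _ _ _ hxy] at this
    exact Exec.branch_false hxy this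

theorem isPrimitive_max : IsPrimitive max :=
  .of_branch (fun _ y => y) (fun x _ => x) (fun _ _ _ h => (max_eq_right h).symm)
    (fun _ _ _ h => (max_eq_left (le_of_not_ge h)).symm)

theorem isPrimitive_indicator : IsPrimitive fun x y => if x ≤ y then 1 else 0 :=
  .of_branch (fun _ _ => .const 1) (fun _ _ => .const 0)
    (fun _ _ _ h => by simp [RealExpr.eval, h]) (fun _ _ _ h => by simp [RealExpr.eval, h])

/-- Array 3 acts as an evaluation stack: `F` is left at position `l` and `G` is computed at `l + 1`,
whose frame protects `l`. Since `G` cannot see array 3, evaluating it after `F` gives its value in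
the original store. -/
theorem Evaluable.op {L : ℕ} {F G : Store → ℝ} {op : ℝ → ℝ → ℝ} (hL : 6 ≤ L)
    (hop : IsPrimitive op) (hF : Evaluable L F) (hG : Evaluable L G) :
    Evaluable L fun s => op (F s) (G s) where
  congr s s' h := by simp only [hF.congr s s' h, hG.congr s s' h]
  exec l := by
    obtain ⟨P, p, hP⟩ := hF.exec l
    obtain ⟨Q, q, hQ⟩ := hG.exec (l + 1)
    obtain ⟨R, hR⟩ := hop l
    refine ⟨.seq P (.seq Q R), p + (q + 2), fun s => ?_⟩
    obtain ⟨t, s', he, ht, hv, hf⟩ := hP s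
    obtain ⟨t', s'', he', ht', hv', hf'⟩ := hQ s'
    obtain ⟨t'', he'', ht''⟩ := hR s''
    refine ⟨_, _, he.seq (he'.seq he''), ?_, ?_, ?_⟩
    · rw [hf.index 0 (by omega), hf.index 1 (by omega)] at ht'
      simp only [Polynomial.eval_add, Polynomial.eval_ofNat]
      omega
    · simp only [Store.setReal_real, and_self, if_true]
      rw [hf'.scratch l (by omega), hv, hv', hG.congr _ _ hf.agree]
    · exact (hf.trans (hf'.mono le_rfl (by omega))).trans (Frame.setReal _ _ _ _ le_rfl)

/-- Left fold of a binary operation over the values `g 0, …, g (N - 1)`, starting from `0`. -/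
def foldUpTo (op : ℝ → ℝ → ℝ) (g : ℕ → ℝ) : ℕ → ℝ
  | 0 => 0
  | x + 1 => op (foldUpTo op g x) (g x)

theorem foldUpTo_congr (op : ℝ → ℝ → ℝ) {g g' : ℕ → ℝ} {N : ℕ} (h : ∀ x < N, g x = g' x) :
    foldUpTo op g N = foldUpTo op g' N := by
  induction N with
  | zero => rfl
  | succ N ih =>
    rw [foldUpTo, foldUpTo, ih fun x hx => h x (by omega), h N (by omega)]

theorem foldUpTo_add (g : ℕ → ℝ) (N : ℕ) :
    foldUpTo (· + ·) g N = ∑ x ∈ Finset.range N, g x := by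
  induction N with
  | zero => rfl
  | succ N ih => rw [foldUpTo, ih, Finset.sum_range_succ]

theorem Agree.setIndex {L : ℕ} {s s' : Store} (h : Agree L s s') (x : ℕ) :
    Agree (L + 1) (s.setIndex L x) (s'.setIndex L x) where
  index k hk hk' := by
    simp only [Store.setIndex_index]
    split_ifs with hkL
    · rfl
    · exact h.index k (by omega) hk'
  real := h.real

/-- Register `L` is the bound variable and stack entry `l` the accumulator. The body has variables
below `L + 1`, so nested folds use distinct registers. -/
theorem Evaluable.fold {L : ℕ} {F : Store → ℝ} {op : ℝ → ℝ → ℝ} (hL : 6 ≤ L)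
    (hop : IsPrimitive op) (b : Bound) (hF : Evaluable (L + 1) F) :
    Evaluable L fun s =>
      foldUpTo op (fun x => F (s.setIndex L x)) (b.val (s.index 0) (s.index 1)) where
  congr s s' h := by
    rw [h.index 0 (by omega) (by omega), h.index 1 (by omega) (by omega)]
    exact foldUpTo_congr _ fun x _ => hF.congr _ _ (h.setIndex x)
  exec l := by
    obtain ⟨P, p, hP⟩ := hF.exec (l + 1)
    obtain ⟨R, hR⟩ := hop l
    refine ⟨.seq (.setReal 3 (.const l) (.const 0) (.const 0)) (Program.count L b (.seq P R)),
      1 + ((Polynomial.X + 1) * ((p + 2) + 2) + 2), fun s => ?_⟩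
    set N := b.val (s.index 0) (s.index 1) with hN
    set s₀ := s.setReal 3 l 0 0 with hs₀
    have hinit := Exec.setReal s 3 (.const l) (.const 0) (.const 0)
    have hzero : RealExpr.eval s (.const 0) = 0 := by simp [RealExpr.eval]
    rw [hzero] at hinit
    let I : ℕ → Store → Prop := fun x s' => s'.index L = x ∧ Frame L l s s' ∧
      s'.real 3 l 0 = foldUpTo op (fun x => F (s.setIndex L x)) x
    obtain ⟨t, s', he, ht, -, hfr, hval⟩ := exec_count (k := L) (b := b) (P := .seq P R) (N := N)
      (B := p.eval (s.index 0 + s.index 1) + 2) I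
      (by
        rintro x s' ⟨h1, h2, -⟩
        exact ⟨h1, by rw [h2.index 0 (by omega), h2.index 1 (by omega)]⟩)
      (by
        rintro x s' hx ⟨h1, h2, h3⟩
        obtain ⟨t, s'', he, ht, hv, hf⟩ := hP s'
        obtain ⟨t', he', ht'⟩ := hR s''
        rw [h2.index 0 (by omega), h2.index 1 (by omega)] at ht
        have hs'' : s''.index L = x := by rw [hf.index L (by omega), h1]
        refine ⟨_, _, he.seq he', by omega, by simpa using hs'', by simp, ?_, ?_⟩
        · exact ((h2.trans (hf.mono (by omega) (by omega))).trans
            (Frame.setReal _ _ _ _ le_rfl)).trans (Frame.setIndex _ _ _ le_rfl)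
        · simp only [Store.setIndex_real, Store.setReal_real, and_self, if_true]
          rw [hf.scratch l (by omega), h3, hv, foldUpTo]
          congr 1
          refine hF.congr _ _ ⟨fun k hk hk' => ?_, fun a ha _ => h2.real a ha⟩
          simp only [Store.setIndex_index]
          split_ifs with hkL
          · rw [hkL, h1]
          · exact h2.index k (by omega))
      s₀ ⟨by simp, (Frame.setReal _ _ _ _ le_rfl).trans (Frame.setIndex _ _ _ le_rfl), by
        simp [hs₀, Store.setReal_real, foldUpTo]⟩
    refine ⟨_, s', hinit.seq he, ?_, hval, hfr⟩
    have hNle : N ≤ _ := b.val_le (s.index 0) (s.index 1)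
    have := Nat.mul_le_mul_right (p.eval (s.index 0 + s.index 1) + 2 + 2) hNle
    simp only [Polynomial.eval_add, Polynomial.eval_mul, Polynomial.eval_X, Polynomial.eval_one,
      Polynomial.eval_ofNat]
    omega

theorem Evaluable.add {L : ℕ} {F G : Store → ℝ} (hL : 6 ≤ L) (hF : Evaluable L F)
    (hG : Evaluable L G) : Evaluable L fun s => F s + G s := hF.op hL isPrimitive_add hG

theorem Evaluable.sub {L : ℕ} {F G : Store → ℝ} (hL : 6 ≤ L) (hF : Evaluable L F)
    (hG : Evaluable L G) : Evaluable L fun s => F s - G s := hF.op hL isPrimitive_sub hG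

theorem Evaluable.mul {L : ℕ} {F G : Store → ℝ} (hL : 6 ≤ L) (hF : Evaluable L F)
    (hG : Evaluable L G) : Evaluable L fun s => F s * G s := hF.op hL isPrimitive_mul hG

theorem Evaluable.div {L : ℕ} {F G : Store → ℝ} (hL : 6 ≤ L) (hF : Evaluable L F)
    (hG : Evaluable L G) : Evaluable L fun s => F s / G s := hF.op hL isPrimitive_div hG

theorem Evaluable.sum {L : ℕ} {F : Store → ℝ} (hL : 6 ≤ L) (b : Bound)
    (hF : Evaluable (L + 1) F) :
    Evaluable L fun s =>
      ∑ x ∈ Finset.range (b.val (s.index 0) (s.index 1)), F (s.setIndex L x) := by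
  simpa only [foldUpTo_add] using hF.fold hL isPrimitive_add b

/-- Both alternatives are computed and mixed by the 0-1 indicator of the test; this is sound because
real terms are total, division by zero included. -/
theorem Evaluable.ite {L : ℕ} {F G H K : Store → ℝ} (hL : 6 ≤ L) (hF : Evaluable L F)
    (hG : Evaluable L G) (hH : Evaluable L H) (hK : Evaluable L K) :
    Evaluable L fun s => if F s ≤ G s then H s else K s := by
  have h := hF.op hL isPrimitive_indicator hG
  have h1 := Evaluable.const L 1
  convert (h.mul hL hH).add hL ((h1.sub hL h).mul hL hK) using 2 with s
  split_ifs <;> simp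

/-! ### Transformations of arrays and their programs -/

/-- Equality of array contents outside the scratch arrays. -/
def SameData (A A' : Arrays) : Prop := ∀ a, a ≠ 3 → a ≠ 4 → A a = A' a

theorem SameData.trans {A A' A'' : Arrays} (h : SameData A A') (h' : SameData A' A'') :
    SameData A A'' := fun a h3 h4 => (h a h3 h4).trans (h' a h3 h4)

/-- A transformation of arrays, depending on `d` and `n`, is implemented by a program that runs in
polynomially many steps and keeps the registers below `c`. -/
structure Implementable (c : ℕ) (F : ℕ → ℕ → Arrays → Arrays) : Prop where
  congr : ∀ d n A A', SameData A A' → SameData (F d n A) (F d n A')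
  exec : ∃ (P : Program) (p : Polynomial ℕ), ∀ s : Store, s.index 2 = 0 → ∃ t s',
    Exec P s t s' ∧ t ≤ p.eval (s.index 0 + s.index 1) ∧ (∀ k < c, s'.index k = s.index k) ∧
    SameData s'.real (F (s.index 0) (s.index 1) s.real)

theorem Implementable.mono {c c' : ℕ} {F : ℕ → ℕ → Arrays → Arrays} (h : Implementable c F)
    (hc : c' ≤ c) : Implementable c' F where
  congr := h.congr
  exec := by
    obtain ⟨P, p, hP⟩ := h.exec
    refine ⟨P, p, fun s hs => ?_⟩
    obtain ⟨t, s', h1, h2, h3, h4⟩ := hP s hs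
    exact ⟨t, s', h1, h2, fun k hk => h3 k (by omega), h4⟩

theorem Implementable.seq {c : ℕ} {F G : ℕ → ℕ → Arrays → Arrays} (hc : 3 ≤ c)
    (hF : Implementable c F) (hG : Implementable c G) :
    Implementable c fun d n A => G d n (F d n A) where
  congr d n A A' h := hG.congr _ _ _ _ (hF.congr _ _ _ _ h)
  exec := by
    obtain ⟨P, p, hP⟩ := hF.exec
    obtain ⟨Q, q, hQ⟩ := hG.exec
    refine ⟨.seq P Q, p + q, fun s hs => ?_⟩
    obtain ⟨t, s', h1, h2, h3, h4⟩ := hP s hs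
    obtain ⟨t', s'', h1', h2', h3', h4'⟩ := hQ s' (by rw [h3 2 (by omega), hs])
    rw [h3 0 (by omega), h3 1 (by omega)] at h2' h4'
    refine ⟨_, s'', h1.seq h1', ?_, fun k hk => (h3' k hk).trans (h3 k hk),
      h4'.trans (hG.congr _ _ _ _ h4)⟩
    simp only [Polynomial.eval_add]
    omega

/-- The counter is register `c`, which the body keeps. Nested iterations can use registers 3, 4, 5,
the ones that `Agree` hides from terms. -/
theorem Implementable.iterate {c : ℕ} {F : ℕ → ℕ → Arrays → Arrays} (hc : 3 ≤ c)
    (b : Bound) (hF : Implementable (c + 1) F) :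
    Implementable c fun d n A => (F d n)^[b.val d n] A where
  congr d n A A' h := by
    generalize b.val d n = N
    induction N with
    | zero => exact h
    | succ N ih =>
      simp only [Function.iterate_succ_apply']
      exact hF.congr _ _ _ _ ih
  exec := by
    obtain ⟨P, p, hP⟩ := hF.exec
    refine ⟨Program.count c b P, (Polynomial.X + 1) * (p + 2) + 2, fun s hs => ?_⟩
    set N := b.val (s.index 0) (s.index 1)
    let I : ℕ → Store → Prop := fun x s' => s'.index c = x ∧ (∀ k < c, s'.index k = s.index k) ∧
      SameData s'.real ((F (s.index 0) (s.index 1))^[x] s.real)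
    obtain ⟨t, s', he, ht, -, hfr, hval⟩ := exec_count (k := c) (b := b) (P := P) (N := N)
      (B := p.eval (s.index 0 + s.index 1)) I
      (by
        rintro x s' ⟨h1, h2, -⟩
        exact ⟨h1, by rw [h2 0 (by omega), h2 1 (by omega)]⟩)
      (by
        rintro x s' hx ⟨h1, h2, h3⟩
        obtain ⟨t, s'', he, ht, hk, hd⟩ := hP s' (by rw [h2 2 (by omega), hs])
        rw [h2 0 (by omega), h2 1 (by omega)] at ht hd
        refine ⟨t, s'', he, ht, by rw [hk c (by omega), h1], by simp, fun k hkc => ?_, ?_⟩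
        · simp only [Store.setIndex_index]
          rw [if_neg (by omega), hk k (by omega), h2 k hkc]
        · rw [Function.iterate_succ_apply']
          exact hd.trans (hF.congr _ _ _ _ h3))
      s ⟨by simp, fun k hk => by simp; omega, fun _ _ _ => rfl⟩
    refine ⟨t, s', he, ht.trans ?_, hfr, hval⟩
    have hNle : N ≤ _ := b.val_le (s.index 0) (s.index 1)
    have := Nat.mul_le_mul_right (p.eval (s.index 0 + s.index 1) + 2) hNle
    simp only [Polynomial.eval_add, Polynomial.eval_mul, Polynomial.eval_X, Polynomial.eval_one,
      Polynomial.eval_ofNat]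
    omega

/-- Filling a rectangle of an array, entry by entry. -/
theorem exec_fill {P : Program} {b₁ b₂ : Bound} {a d n B : ℕ} (v : ℕ → ℕ → ℝ)
    (J : Store → Prop) (hJd : ∀ s, J s → s.index 0 = d ∧ s.index 1 = n)
    (hJ6 : ∀ s x, J s → J (s.setIndex 6 x)) (hJ7 : ∀ s x, J s → J (s.setIndex 7 x))
    (hP : ∀ s i j, J s → s.index 6 = i → s.index 7 = j → i < b₁.val d n → j < b₂.val d n →
      ∃ t s', Exec P s t s' ∧ t ≤ B ∧ s'.index 6 = i ∧ s'.index 7 = j ∧ J s' ∧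
        ∀ i' j', s'.real a i' j' = if i' = i ∧ j' = j then v i j else s.real a i' j')
    (s : Store) (hs : J s) :
    ∃ t s', Exec (Program.count 6 b₁ (Program.count 7 b₂ P)) s t s' ∧
      t ≤ (d + n + 1) * (((d + n + 1) * (B + 2) + 2) + 2) + 2 ∧ J s' ∧
      ∀ i j, s'.real a i j =
        if i < b₁.val d n ∧ j < b₂.val d n then v i j else s.real a i j := by
  have hrow : ∀ x s, x < b₁.val d n → J s → s.index 6 = x → ∃ t s',
      Exec (Program.count 7 b₂ P) s t s' ∧ t ≤ b₂.val d n * (B + 2) + 2 ∧ s'.index 6 = x ∧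
      J s' ∧ ∀ i j, s'.real a i j =
        if i = x ∧ j < b₂.val d n then v i j else s.real a i j := by
    intro x s hx hJ h6
    let I : ℕ → Store → Prop := fun m s' => s'.index 7 = m ∧ s'.index 6 = x ∧ J s' ∧
      ∀ i j, s'.real a i j = if i = x ∧ j < m then v i j else s.real a i j
    obtain ⟨t, s', he, ht, -, h1, h2, h3⟩ := exec_count (k := 7) (b := b₂) (P := P)
      (N := b₂.val d n) (B := B) I
      (by
        rintro m s' ⟨h1, -, h2, -⟩
        rw [(hJd _ h2).1, (hJd _ h2).2]
        exact ⟨h1, rfl⟩)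
      (by
        rintro m s' hm ⟨h1, h2, h3, h4⟩
        obtain ⟨t, s'', he, ht, k6, k7, hJ', hr⟩ := hP s' x m h3 h2 h1 hx hm
        refine ⟨t, s'', he, ht, k7, by simp, by simpa using k6, hJ7 _ _ hJ', fun i j => ?_⟩
        rw [Store.setIndex_real, hr, h4]
        by_cases hi : i = x
        · by_cases hj : j = m
          · simp [hi, hj]
          · have : j < m + 1 ↔ j < m := by omega
            simp [hi, hj, this]
        · simp [hi])
      s ⟨by simp, by simpa using h6, hJ7 _ _ hJ, fun i j => by simp⟩
    exact ⟨t, s', he, ht, h1, h2, h3⟩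
  let I : ℕ → Store → Prop := fun m s' => s'.index 6 = m ∧ J s' ∧
    ∀ i j, s'.real a i j = if i < m ∧ j < b₂.val d n then v i j else s.real a i j
  obtain ⟨t, s', he, ht, -, h2, h3⟩ := exec_count (k := 6) (b := b₁)
    (P := Program.count 7 b₂ P) (N := b₁.val d n) (B := b₂.val d n * (B + 2) + 2) I
    (by
      rintro m s' ⟨h1, h2, -⟩
      rw [(hJd _ h2).1, (hJd _ h2).2]
      exact ⟨h1, rfl⟩)
    (by
      rintro m s' hm ⟨h1, h2, h3⟩
      obtain ⟨t, s'', he, ht, k6, hJ', hr⟩ := hrow m s' hm h2 h1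
      refine ⟨t, s'', he, ht, k6, by simp, hJ6 _ _ hJ', fun i j => ?_⟩
      rw [Store.setIndex_real, hr, h3]
      by_cases hi : i = m
      · simp [hi]
      · have : i < m + 1 ↔ i < m := by omega
        simp [hi, this])
    s ⟨by simp, hJ6 _ _ hs, fun i j => by simp⟩
  refine ⟨t, s', he, ht.trans ?_, h2, h3⟩
  have := b₁.val_le d n
  have := b₂.val_le d n
  gcongr

/-- The store with arrays `A` in which registers `6` and `7` hold `i` and `j`. -/
def at₂ (d n i j : ℕ) (A : Arrays) : Store where
  index := fun k => if k = 0 then d else if k = 1 then n else if k = 6 then i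
    else if k = 7 then j else 0
  real := A

/-- Simultaneous assignment of `T` to the entries of a rectangle of the array `a`. -/
def assign (a : ℕ) (b₁ b₂ : Bound) (T : Store → ℝ) (d n : ℕ) (A : Arrays) : Arrays :=
  Function.update A a fun i j =>
    if i < b₁.val d n ∧ j < b₂.val d n then T (at₂ d n i j A) else A a i j

/-- The values are staged in array 4 and copied afterwards, so the assignment is simultaneous even
if `T` reads array `a`, as the matrix product does. Register 2 stays zero and serves as the constant
index 0 in terms. -/
theorem Evaluable.assign {T : Store → ℝ} (hT : Evaluable 8 T) {a : ℕ} (h3 : a ≠ 3) (h4 : a ≠ 4)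
    (b₁ b₂ : Bound) : Implementable 6 (assign a b₁ b₂ T) where
  congr d n A A' h := by
    intro a' h3' h4'
    by_cases ha : a' = a
    · subst ha
      simp only [RealRAM.assign, Function.update_self]
      funext i j
      rw [h a' h3' h4', hT.congr (at₂ d n i j A) (at₂ d n i j A') ⟨fun _ _ _ => rfl, h⟩]
    · simp only [RealRAM.assign, Function.update_of_ne ha]
      exact h a' h3' h4'
  exec := by
    obtain ⟨P, p, hP⟩ := hT.exec 0
    let body₁ : Program := .seq P (.setReal 4 (.reg 6) (.reg 7) (.entry 3 (.const 0) (.const 0)))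
    let body₂ : Program := .setReal a (.reg 6) (.reg 7) (.entry 4 (.reg 6) (.reg 7))
    refine ⟨.seq (Program.count 6 b₁ (Program.count 7 b₂ body₁))
      (Program.count 6 b₁ (Program.count 7 b₂ body₂)),
      ((Polynomial.X + 1) * (((Polynomial.X + 1) * ((p + 1) + 2) + 2) + 2) + 2) +
      ((Polynomial.X + 1) * (((Polynomial.X + 1) * (1 + 2) + 2) + 2) + 2), fun s hs => ?_⟩
    set d := s.index 0 with hd
    set n := s.index 1 with hn
    let v : ℕ → ℕ → ℝ := fun i j => T (at₂ d n i j s.real)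
    obtain ⟨t, s', he, ht, ⟨hi', hr'⟩, hv'⟩ := exec_fill (P := body₁) (b₁ := b₁) (b₂ := b₂)
      (a := 4) (d := d) (n := n) (B := p.eval (d + n) + 1) v
      (fun s' => (∀ k < 6, s'.index k = s.index k) ∧ SameData s'.real s.real)
      (fun s' h => ⟨h.1 0 (by omega), h.1 1 (by omega)⟩)
      (fun s' x h => ⟨fun k hk => by rw [Store.setIndex_index, if_neg (by omega), h.1 k hk], h.2⟩)
      (fun s' x h => ⟨fun k hk => by rw [Store.setIndex_index, if_neg (by omega), h.1 k hk], h.2⟩)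
      (by
        rintro s' i j ⟨hk, hr⟩ h6 h7 - -
        obtain ⟨t, s'', he, ht, hv, hf⟩ := hP s'
        rw [hk 0 (by omega), hk 1 (by omega), ← hd, ← hn] at ht
        refine ⟨_, _, he.seq (Exec.setReal _ _ _ _ _), by omega, ?_, ?_, ⟨?_, ?_⟩, ?_⟩
        · simp [hf.index 6 (by omega), h6]
        · simp [hf.index 7 (by omega), h7]
        · intro k hk6
          rw [Store.setReal_index, hf.index k (by omega), hk k hk6]
        · intro a' h3' h4'
          rw [Store.setReal_real_of_ne _ h4', hf.real a' h3', hr a' h3' h4']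
        · intro i' j'
          simp only [Store.setReal_real, IndexExpr.eval, RealExpr.eval, true_and,
            hf.index 6 (by omega), hf.index 7 (by omega), h6, h7, hv, hf.real 4 (by omega)]
          congr 1
          refine hT.congr _ _ ⟨fun k hk8 hk' => ?_, hr⟩
          have hk'' : k = 0 ∨ k = 1 ∨ k = 2 ∨ k = 6 ∨ k = 7 := by omega
          rcases hk'' with rfl | rfl | rfl | rfl | rfl
          · exact hk 0 (by omega)
          · exact hk 1 (by omega)
          · simp [at₂, hk 2 (by omega), hs]
          · simp [at₂, h6]
          · simp [at₂, h7])
      s ⟨fun _ _ => rfl, fun _ _ _ => rfl⟩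
    obtain ⟨t₂, s₂, he₂, ht₂, ⟨hi₂, hr₂, -⟩, hv₂⟩ := exec_fill (P := body₂) (b₁ := b₁) (b₂ := b₂)
      (a := a) (d := d) (n := n) (B := 1) (fun i j => s'.real 4 i j)
      (fun s₂ => (∀ k < 6, s₂.index k = s.index k) ∧
        (∀ a', a' ≠ a → s₂.real a' = s'.real a') ∧ True)
      (fun s₂ h => ⟨h.1 0 (by omega), h.1 1 (by omega)⟩)
      (fun s₂ x h => ⟨fun k hk => by rw [Store.setIndex_index, if_neg (by omega), h.1 k hk], h.2⟩)
      (fun s₂ x h => ⟨fun k hk => by rw [Store.setIndex_index, if_neg (by omega), h.1 k hk], h.2⟩)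
      (by
        rintro s₂ i j ⟨hk, hr, -⟩ h6 h7 - -
        refine ⟨_, _, Exec.setReal _ _ _ _ _, le_rfl, h6, h7, ⟨hk, fun a' ha' => ?_, trivial⟩, ?_⟩
        · rw [Store.setReal_real_of_ne _ ha', hr a' ha']
        · intro i' j'
          simp only [Store.setReal_real, IndexExpr.eval, RealExpr.eval, true_and, h6, h7,
            hr 4 h4.symm])
      s' ⟨hi', fun _ _ => rfl, trivial⟩
    refine ⟨_, s₂, he.seq he₂, ?_, hi₂, ?_⟩
    · simp only [Polynomial.eval_add, Polynomial.eval_mul, Polynomial.eval_X, Polynomial.eval_one,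
        Polynomial.eval_ofNat]
      exact add_le_add ht ht₂
    · intro a' h3' h4'
      by_cases ha : a' = a
      · subst ha
        funext i j
        simp only [RealRAM.assign, Function.update_self, hv₂, hv', v, hr' a' h3' h4']
        split_ifs <;> rfl
      · rw [hr₂ a' ha, hr' a' h3' h4', RealRAM.assign, Function.update_of_ne ha]

end RealRAM

/-! ### From stability to inequalities for projections -/

/-- If all sums of `m` of the nonnegative numbers `a i` are at most `A`, then fractional sums with
weights in `[0, 1]` are bounded accordingly. -/
theorem sum_mul_le_of_card_eq {n : ℕ} {a u : Fin n → ℝ} (ha : ∀ i, 0 ≤ a i) {m : ℕ} (hm : 0 < m)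
    (hmn : m ≤ n) {A : ℝ} (hA : ∀ R : Finset (Fin n), R.card = m → ∑ i ∈ R, a i ≤ A)
    (hu0 : ∀ i, 0 ≤ u i) (hu1 : ∀ i, u i ≤ 1) :
    ∑ i, u i * a i ≤ A + A / m * ∑ i, u i := by
  have hne : ((Finset.univ : Finset (Fin n)).powersetCard m).Nonempty :=
    Finset.powersetCard_nonempty.2 (by simpa using hmn)
  obtain ⟨R, hR, hmax⟩ := Finset.exists_max_image _ (fun R => ∑ i ∈ R, a i) hne
  have hRc : R.card = m := (Finset.mem_powersetCard.1 hR).2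
  have hm' : (0 : ℝ) < m := by exact_mod_cast hm
  have hA0 : 0 ≤ A := (Finset.sum_nonneg fun i _ => ha i).trans (hA R hRc)
  -- Exchange argument: a term outside a maximizing `R` is at most every term in `R`, hence at most
  -- their average.
  have hout : ∀ j ∉ R, a j ≤ A / m := by
    intro j hj
    have hle : ∀ i ∈ R, a j ≤ a i := by
      intro i hi
      have hj' : j ∉ R.erase i := fun h => hj (Finset.mem_of_mem_erase h)
      have := hmax (insert j (R.erase i)) (Finset.mem_powersetCard.2 ⟨Finset.subset_univ _, by
        rw [Finset.card_insert_of_notMem hj', Finset.card_erase_of_mem hi]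
        omega⟩)
      rw [Finset.sum_insert hj', ← Finset.add_sum_erase R a hi] at this
      linarith
    have h1 := Finset.card_nsmul_le_sum R a (a j) hle
    rw [hRc, nsmul_eq_mul] at h1
    rw [le_div_iff₀ hm']
    linarith [hA R hRc]
  rw [← Finset.sum_add_sum_compl R]
  have h1 : ∑ i ∈ R, u i * a i ≤ A :=
    (Finset.sum_le_sum fun i _ => mul_le_of_le_one_left (ha i) (hu1 i)).trans (hA R hRc)
  have h2 : ∑ i ∈ Rᶜ, u i * a i ≤ A / m * ∑ i ∈ Rᶜ, u i := by
    rw [Finset.mul_sum]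
    refine Finset.sum_le_sum fun i hi => ?_
    rw [mul_comm]
    exact mul_le_mul_of_nonneg_right (hout i (by simpa using hi)) (hu0 i)
  have h3 : ∑ i ∈ Rᶜ, u i ≤ ∑ i, u i :=
    Finset.sum_le_sum_of_subset_of_nonneg (Finset.subset_univ _) fun i _ _ => hu0 i
  have h4 := mul_le_mul_of_nonneg_left h3 (div_nonneg hA0 hm'.le)
  linarith

/-- Projections `p i = ⟪r, z i⟫` of centred stable points to a vector `r` with `‖r‖ ^ 2 = q`, where
`D = δ² / (3 ε)`: the mean is small, the second moment is about `q`, and small fractions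
of the points carry little of it. -/
structure Clean {n : ℕ} (ε D q : ℝ) (p : Fin n → ℝ) : Prop where
  mean : (∑ i, p i) ^ 2 ≤ 3 * ε * D * n ^ 2 * q
  lower : (1 - D) * n * q ≤ ∑ i, p i ^ 2
  upper : ∑ i, p i ^ 2 ≤ (1 + D) * n * q
  small : ∀ u : Fin n → ℝ, (∀ i, 0 ≤ u i) → (∀ i, u i ≤ 1) → ∑ i, u i ≤ 3 * ε * n →
    ∑ i, u i * p i ^ 2 ≤ 9 * D * n * q

theorem Clean.comp_perm {n : ℕ} {ε D q : ℝ} {p : Fin n → ℝ} (h : Clean ε D q p)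
    (σ : Equiv.Perm (Fin n)) : Clean ε D q fun i => p (σ i) where
  mean := by rw [Equiv.sum_comp σ p]; exact h.mean
  lower := by rw [Equiv.sum_comp σ fun i => p i ^ 2]; exact h.lower
  upper := by rw [Equiv.sum_comp σ fun i => p i ^ 2]; exact h.upper
  small u h0 h1 hu := by
    have := h.small (fun i => u (σ.symm i)) (fun i => h0 _) (fun i => h1 _)
      (by rwa [Equiv.sum_comp σ.symm u])
    rw [← Equiv.sum_comp σ] at this
    simpa using this

theorem IsStable.sum_sq {d n : ℕ} {ε δ : ℝ} {X : Measure (EuclideanSpace ℝ (Fin d))}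
    {x : Fin n → EuclideanSpace ℝ (Fin d)} (h : IsStable ε δ X x) (hn : 0 < n)
    (r : EuclideanSpace ℝ (Fin d)) (S : Finset (Fin n)) (hS : (1 - ε) * (n : ℝ) ≤ S.card) :
    |∑ i ∈ S, (inner ℝ r (x i - distMean X)) ^ 2 - S.card * ‖r‖ ^ 2| ≤
      δ ^ 2 / ε * S.card * ‖r‖ ^ 2 := by
  rcases eq_or_ne r 0 with rfl | hr
  · simp
  have hr' : 0 < ‖r‖ := norm_pos_iff.2 hr
  have hc : (0 : ℝ) < S.card := by
    have : (0 : ℝ) < n := by exact_mod_cast hn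
    have := mul_pos (by linarith [h.eps_lt_half] : (0 : ℝ) < 1 - ε) this
    linarith
  have key := h.variance_close (‖r‖⁻¹ • r) (by simp [norm_smul, hr'.ne']) S hS
  have hsum : ∑ i ∈ S, (inner ℝ (‖r‖⁻¹ • r) (x i - distMean X)) ^ 2 =
      (‖r‖ ^ 2)⁻¹ * ∑ i ∈ S, (inner ℝ r (x i - distMean X)) ^ 2 := by
    rw [Finset.mul_sum]
    refine Finset.sum_congr rfl fun i _ => ?_
    rw [real_inner_smul_left, mul_pow, inv_pow]
  rw [hsum] at key
  have hpos : 0 < (S.card : ℝ) * ‖r‖ ^ 2 := by positivity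
  have := mul_le_mul_of_nonneg_right key hpos.le
  rw [← abs_of_pos hpos, ← abs_mul, abs_of_pos hpos] at this
  have e : (1 / (S.card : ℝ) * ((‖r‖ ^ 2)⁻¹ * ∑ i ∈ S, inner ℝ r (x i - distMean X) ^ 2) - 1) *
      (S.card * ‖r‖ ^ 2) = ∑ i ∈ S, inner ℝ r (x i - distMean X) ^ 2 - S.card * ‖r‖ ^ 2 := by
    field_simp
  rwa [e, ← mul_assoc] at this

theorem IsStable.sum_le {d n : ℕ} {ε δ : ℝ} {X : Measure (EuclideanSpace ℝ (Fin d))}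
    {x : Fin n → EuclideanSpace ℝ (Fin d)} (h : IsStable ε δ X x) (hn : 0 < n)
    (r : EuclideanSpace ℝ (Fin d)) :
    |∑ i, inner ℝ r (x i - distMean X)| ≤ δ * n * ‖r‖ := by
  rcases eq_or_ne r 0 with rfl | hr
  · simp
  have hr' : 0 < ‖r‖ := norm_pos_iff.2 hr
  have hn' : (0 : ℝ) < n := by exact_mod_cast hn
  have key := h.mean_close (‖r‖⁻¹ • r) (by simp [norm_smul, hr'.ne']) Finset.univ (by
    simp only [Finset.card_univ, Fintype.card_fin]
    nlinarith [h.eps_pos])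
  simp only [real_inner_smul_left, ← Finset.mul_sum, Finset.card_univ, Fintype.card_fin] at key
  have hpos : 0 < (n : ℝ) * ‖r‖ := by positivity
  have := mul_le_mul_of_nonneg_right key hpos.le
  rw [← abs_of_pos hpos, ← abs_mul, abs_of_pos hpos] at this
  have e : 1 / (n : ℝ) * (‖r‖⁻¹ * ∑ i, inner ℝ r (x i - distMean X)) * (n * ‖r‖) =
      ∑ i, inner ℝ r (x i - distMean X) := by
    field_simp
  rwa [e, ← mul_assoc] at this

/-- The second moment of a small set R is that of all points minus that of Rᶜ, both controlled by
stability; with |R| ≤ 3εn ≤ Dn this gives 3Dnq. Sets of size m = ⌊3εn⌋ are used, positive because 1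
≤ εn, and passing to fractional weights of total below m + 1 ≤ 2m costs a factor 3. -/
theorem IsStable.clean {d n : ℕ} {ε δ : ℝ} {X : Measure (EuclideanSpace ℝ (Fin d))}
    {x : Fin n → EuclideanSpace ℝ (Fin d)} (h : IsStable (3 * ε) δ X x) (hn : 0 < n)
    (hεn : 1 ≤ ε * n) (r : EuclideanSpace ℝ (Fin d)) :
    Clean ε (δ ^ 2 / (3 * ε)) (‖r‖ ^ 2) fun i => inner ℝ r (x i - distMean X) := by
  have hε := h.eps_pos
  have hε2 := h.eps_lt_half
  have hδ := h.eps_le_delta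
  have hn' : (0 : ℝ) < n := by exact_mod_cast hn
  set D := δ ^ 2 / (3 * ε) with hD
  have hDε : 3 * ε ≤ D := by
    rw [hD, le_div_iff₀ hε]
    nlinarith
  have hD0 : 0 ≤ D := by linarith
  have hεD : 3 * ε * D = δ ^ 2 := by
    rw [hD]
    exact mul_div_cancel₀ _ hε.ne'
  set q := ‖r‖ ^ 2 with hq
  have hq0 : 0 ≤ q := by positivity
  have hall := h.sum_sq hn r Finset.univ (by
    simp only [Finset.card_univ, Fintype.card_fin]
    nlinarith [h.eps_pos])
  simp only [Finset.card_univ, Fintype.card_fin] at hall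
  rw [abs_le] at hall
  refine ⟨?_, by linarith, by linarith, ?_⟩
  · have := sq_le_sq' (abs_le.1 (h.sum_le hn r)).1 (abs_le.1 (h.sum_le hn r)).2
    rw [hεD, hq]
    linarith
  · intro u hu0 hu1 hu
    set m := ⌊3 * ε * n⌋₊ with hmdef
    have hm1 : (m : ℝ) ≤ 3 * ε * n := Nat.floor_le (by positivity)
    have hm2 : 3 * ε * n < m + 1 := Nat.lt_floor_add_one _
    have hm0 : 0 < m := Nat.floor_pos.2 (by nlinarith)
    have hm0' : (1 : ℝ) ≤ m := by exact_mod_cast hm0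
    have hmn : m ≤ n := by
      have : (m : ℝ) ≤ n := by nlinarith
      exact_mod_cast this
    have hR : ∀ R : Finset (Fin n), R.card = m →
        ∑ i ∈ R, (inner ℝ r (x i - distMean X)) ^ 2 ≤ 3 * D * n * q := by
      intro R hR
      have hcard : (Rᶜ.card : ℝ) = n - m := by
        rw [Finset.card_compl, hR, Fintype.card_fin, Nat.cast_sub hmn]
      have hc := h.sum_sq hn r Rᶜ (by rw [hcard]; linarith)
      rw [hcard, abs_le] at hc
      have hsplit := Finset.sum_add_sum_compl R fun i => (inner ℝ r (x i - distMean X)) ^ 2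
      have e1 : (m : ℝ) * q ≤ D * n * q := by
        have := mul_le_mul_of_nonneg_right hDε hn'.le
        exact mul_le_mul_of_nonneg_right (by linarith) hq0
      have e2 : 0 ≤ D * m * q := by positivity
      linarith [hc.1, hall.2]
    refine (sum_mul_le_of_card_eq (fun i => sq_nonneg _) hm0 hmn hR hu0 hu1).trans ?_
    have hA : 0 ≤ 3 * D * n * q := by positivity
    have : 3 * D * n * q / m * ∑ i, u i ≤ 3 * D * n * q * 2 := by
      rw [div_mul_eq_mul_div, div_le_iff₀ (by linarith), mul_assoc _ 2]
      exact mul_le_mul_of_nonneg_left (by linarith) hA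
    linarith

/-! ### Estimates in one direction -/

section Scalar

variable {n : ℕ} {ε D q : ℝ} {p b w : Fin n → ℝ} {G : Finset (Fin n)} {a : ℝ}

theorem sum_mul_sq_le {ι : Type*} (s : Finset ι) {u f : ι → ℝ} (hu : ∀ i ∈ s, 0 ≤ u i) :
    (∑ i ∈ s, u i * f i) ^ 2 ≤ (∑ i ∈ s, u i) * ∑ i ∈ s, u i * f i ^ 2 :=
  Finset.sum_sq_le_sum_mul_sum_of_sq_le_mul s hu (fun i hi => mul_nonneg (hu i hi) (sq_nonneg _))
    fun i _ => le_of_eq (by ring)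

/-- The missing weight, 1 - w on `G` and 1 elsewhere, has total at most 3εn. So `small` bounds its
second moment and Cauchy–Schwarz its first; 60 = 2(3 + 27). -/
theorem Clean.good_sums (h : Clean ε D q p) (hε : 0 < ε)
    (hw0 : ∀ i, 0 ≤ w i) (hw1 : ∀ i, w i ≤ 1) (hG : (1 - 3 * ε) * n ≤ ∑ i ∈ G, w i) :
    (∑ i ∈ G, w i * p i) ^ 2 ≤ 60 * ε * D * n ^ 2 * q ∧
      (1 - 10 * D) * n * q ≤ ∑ i ∈ G, w i * p i ^ 2 ∧
      ∑ i ∈ G, w i * p i ^ 2 ≤ (1 + D) * n * q := by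
  set u : Fin n → ℝ := fun i => 1 - if i ∈ G then w i else 0 with hu
  have hu0 : ∀ i, 0 ≤ u i := fun i => by
    simp only [hu]
    split_ifs <;> linarith [hw1 i]
  have hu1 : ∀ i, u i ≤ 1 := fun i => by
    simp only [hu]
    split_ifs <;> linarith [hw0 i]
  have hsum : ∀ f : Fin n → ℝ, ∑ i, u i * f i = ∑ i, f i - ∑ i ∈ G, w i * f i := by
    intro f
    simp only [hu, sub_mul, one_mul, Finset.sum_sub_distrib, ite_mul, zero_mul,
      Finset.sum_ite_mem, Finset.univ_inter]
  have hus : ∑ i, u i ≤ 3 * ε * n := by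
    have := hsum fun _ => 1
    simp only [mul_one, Finset.sum_const, Finset.card_univ, Fintype.card_fin, nsmul_eq_mul] at this
    linarith
  have hsm := h.small u hu0 hu1 hus
  have hsq := sum_mul_sq_le Finset.univ (f := p) fun i _ => hu0 i
  have hup0 : 0 ≤ ∑ i, u i * p i ^ 2 :=
    Finset.sum_nonneg fun i _ => mul_nonneg (hu0 i) (sq_nonneg _)
  have hsq' : (∑ i, u i * p i) ^ 2 ≤ 27 * ε * D * n ^ 2 * q := by
    refine hsq.trans ((mul_le_mul hus hsm hup0 (by positivity)).trans (le_of_eq (by ring)))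
  have e1 := hsum p
  have e2 := hsum fun i => p i ^ 2
  refine ⟨?_, by linarith [h.lower], by linarith [h.upper]⟩
  have : ∑ i ∈ G, w i * p i = ∑ i, p i - ∑ i, u i * p i := by linarith
  rw [this]
  nlinarith [h.mean, sq_nonneg (∑ i, p i + ∑ i, u i * p i)]

theorem sum_compl_le_card (hw1 : ∀ i, w i ≤ 1) (hB : (Gᶜ.card : ℝ) ≤ ε * n) :
    ∑ i ∈ Gᶜ, w i ≤ ε * n := by
  refine (Finset.sum_le_card_nsmul Gᶜ w 1 fun i _ => hw1 i).trans ?_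
  simpa using hB

theorem sum_compl_sq_le (hw0 : ∀ i, 0 ≤ w i) (hw1 : ∀ i, w i ≤ 1)
    (hB : (Gᶜ.card : ℝ) ≤ ε * n) (f : Fin n → ℝ) :
    (∑ i ∈ Gᶜ, w i * f i) ^ 2 ≤ ε * n * ∑ i ∈ Gᶜ, w i * f i ^ 2 :=
  (sum_mul_sq_le Gᶜ fun i _ => hw0 i).trans (mul_le_mul_of_nonneg_right
    (sum_compl_le_card hw1 hB) (Finset.sum_nonneg fun i _ => mul_nonneg (hw0 i) (sq_nonneg _)))

/-- If the weighted second moment about the weighted mean is not much larger than expected, then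
the weighted mean is close to the true one. -/
theorem Clean.mean_sq_le (h : Clean ε D q p) (hε : 0 < ε) (hε' : ε < 1 / 6) (hn : 0 < n)
    (hw0 : ∀ i, 0 ≤ w i) (hw1 : ∀ i, w i ≤ 1)
    (hb : ∀ i ∈ G, b i = p i) (hB : (Gᶜ.card : ℝ) ≤ ε * n)
    (hW : (1 - 2 * ε) * n ≤ ∑ i, w i) (ha : a * ∑ i, w i = ∑ i, w i * b i) {K : ℝ}
    (hM : ∑ i, w i * (b i - a) ^ 2 ≤ (1 + K * D) * n * q) :
    a ^ 2 ≤ 9 * (K + 70) * ε * D * q := by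
  have hn' : (0 : ℝ) < n := by exact_mod_cast hn
  set W := ∑ i, w i
  have hsplitW := Finset.sum_add_sum_compl G w
  have hBw := sum_compl_le_card hw1 hB
  obtain ⟨hg, hlow, -⟩ := h.good_sums hε (G := G) hw0 hw1 (by linarith)
  set g := ∑ i ∈ G, w i * p i
  have hsplit := Finset.sum_add_sum_compl G fun i => w i * b i
  have hsplit2 := Finset.sum_add_sum_compl G fun i => w i * b i ^ 2
  have e1 : ∑ i ∈ G, w i * b i = g := Finset.sum_congr rfl fun i hi => by rw [hb i hi]
  have e2 : ∑ i ∈ G, w i * b i ^ 2 = ∑ i ∈ G, w i * p i ^ 2 :=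
    Finset.sum_congr rfl fun i hi => by rw [hb i hi]
  have hbad := sum_compl_sq_le hw0 hw1 hB b
  have e3 : ∑ i ∈ Gᶜ, w i * b i = W * a - g := by linarith
  rw [e3] at hbad
  set SB := ∑ i ∈ Gᶜ, w i * b i ^ 2
  have hvar : ∑ i, w i * (b i - a) ^ 2 = ∑ i, w i * b i ^ 2 - W * a ^ 2 := by
    have : ∀ i, w i * (b i - a) ^ 2 = w i * b i ^ 2 - 2 * a * (w i * b i) + a ^ 2 * w i :=
      fun i => by ring
    simp only [this, Finset.sum_add_distrib, Finset.sum_sub_distrib, ← Finset.mul_sum, ← ha]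
    ring
  have hmain : SB - W * a ^ 2 ≤ (K + 10) * D * n * q := by linarith
  have hWlow : 2 / 3 * n ≤ W := by nlinarith
  have h1 : W ^ 2 * a ^ 2 / 2 - 60 * ε * D * n ^ 2 * q ≤ ε * n * SB := by
    nlinarith [sq_nonneg (W * a - 2 * g)]
  have h2 : ε * n * (SB - W * a ^ 2) ≤ ε * n * ((K + 10) * D * n * q) :=
    mul_le_mul_of_nonneg_left hmain (by positivity)
  -- The term εnWa² returning from the variance is absorbed: W ≥ 2n/3 and W/2 - εn ≥ n/6.
  have h3 : n ^ 2 / 9 * a ^ 2 ≤ (W ^ 2 / 2 - ε * n * W) * a ^ 2 := by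
    refine mul_le_mul_of_nonneg_right ?_ (sq_nonneg _)
    have : ε * n * W ≤ 1 / 6 * n * W :=
      mul_le_mul_of_nonneg_right (by nlinarith) (by nlinarith)
    nlinarith
  have h4 : n ^ 2 * a ^ 2 ≤ n ^ 2 * (9 * (K + 70) * ε * D * q) := by linarith
  exact le_of_mul_le_mul_left h4 (by positivity)

/-- Deviations from the weighted mean cancel in total, so those of the bad points sum to aV - g,
with V the good weight. Cauchy–Schwarz over bad weight at most εn turns the mean error into a bad
second moment. -/
theorem Clean.bad_lower (h : Clean ε D q p) (hε : 0 < ε) (hε' : ε < 1 / 6)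
    (hw0 : ∀ i, 0 ≤ w i) (hw1 : ∀ i, w i ≤ 1)
    (hb : ∀ i ∈ G, b i = p i) (hB : (Gᶜ.card : ℝ) ≤ ε * n)
    (hG : (1 - 2 * ε) * n ≤ ∑ i ∈ G, w i) (ha : a * ∑ i, w i = ∑ i, w i * b i) :
    2 / 9 * n ^ 2 * a ^ 2 - 60 * ε * D * n ^ 2 * q ≤
      ε * n * ∑ i ∈ Gᶜ, w i * (b i - a) ^ 2 := by
  have hεn : 0 ≤ ε * n := by positivity
  obtain ⟨hg, -, -⟩ := h.good_sums hε (G := G) hw0 hw1 (by linarith)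
  refine le_trans ?_ (sum_compl_sq_le hw0 hw1 hB fun i => b i - a)
  have hsplitW := Finset.sum_add_sum_compl G w
  have hsplit := Finset.sum_add_sum_compl G fun i => w i * b i
  have e1 : ∑ i ∈ G, w i * b i = ∑ i ∈ G, w i * p i :=
    Finset.sum_congr rfl fun i hi => by rw [hb i hi]
  have e2 : ∑ i ∈ Gᶜ, w i * (b i - a) = a * ∑ i ∈ G, w i - ∑ i ∈ G, w i * p i := by
    simp only [mul_sub, Finset.sum_sub_distrib, ← Finset.sum_mul]
    rw [← hsplitW] at ha
    linarith
  rw [e2]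
  set g := ∑ i ∈ G, w i * p i
  set V := ∑ i ∈ G, w i
  have hV : 2 / 3 * n ≤ V := by
    have : (0 : ℝ) ≤ n := by positivity
    nlinarith
  have h3 : 4 / 9 * n ^ 2 * a ^ 2 ≤ V ^ 2 * a ^ 2 := by
    refine mul_le_mul_of_nonneg_right ?_ (sq_nonneg _)
    have : (0 : ℝ) ≤ n := by positivity
    nlinarith
  nlinarith [sq_nonneg (a * V - 2 * g)]

theorem Clean.good_upper (h : Clean ε D q p) (hε : 0 < ε) (hε' : ε < 1 / 6) (hn : 0 < n)
    (hD : 0 ≤ D) (hq : 0 ≤ q) (hw0 : ∀ i, 0 ≤ w i) (hw1 : ∀ i, w i ≤ 1)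
    (hb : ∀ i ∈ G, b i = p i) (hG : (1 - 3 * ε) * n ≤ ∑ i ∈ G, w i) :
    ∑ i ∈ G, w i * (b i - a) ^ 2 ≤ (1 + 11 * D) * n * q + 2 * n * a ^ 2 := by
  have hn' : (0 : ℝ) < n := by exact_mod_cast hn
  obtain ⟨hg, -, hup⟩ := h.good_sums hε (G := G) hw0 hw1 hG
  have e1 : ∑ i ∈ G, w i * (b i - a) ^ 2 =
      ∑ i ∈ G, w i * p i ^ 2 - 2 * a * ∑ i ∈ G, w i * p i + a ^ 2 * ∑ i ∈ G, w i := by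
    simp only [Finset.mul_sum, ← Finset.sum_sub_distrib, ← Finset.sum_add_distrib]
    exact Finset.sum_congr rfl fun i hi => by rw [hb i hi]; ring
  have hV : ∑ i ∈ G, w i ≤ n := by
    refine (Finset.sum_le_card_nsmul G w 1 fun i _ => hw1 i).trans ?_
    simpa using (Finset.card_le_univ G)
  rw [e1]
  set g := ∑ i ∈ G, w i * p i
  have h1 : a ^ 2 * ∑ i ∈ G, w i ≤ a ^ 2 * n := mul_le_mul_of_nonneg_left hV (sq_nonneg _)
  -- From (na + g)² ≥ 0 and g² ≤ 60εDn²q ≤ 10Dn²q.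
  have h2 : n * (-(2 * a * g)) ≤ n * (n * a ^ 2 + 10 * D * n * q) := by
    have h5 : 0 ≤ D * n ^ 2 * q := by positivity
    have h6 : ε * (D * n ^ 2 * q) ≤ 1 / 6 * (D * n ^ 2 * q) :=
      mul_le_mul_of_nonneg_right hε'.le h5
    nlinarith [sq_nonneg (n * a + g)]
  have := le_of_mul_le_mul_left h2 hn'
  linarith

theorem Clean.small_upper (h : Clean ε D q p) {u : Fin n → ℝ} (hu0 : ∀ i, 0 ≤ u i)
    (hu1 : ∀ i, u i ≤ 1) (hb : ∀ i ∈ G, b i = p i) (huG : ∀ i ∉ G, u i = 0)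
    (hu : ∑ i, u i ≤ 3 * ε * n) :
    ∑ i, u i * (b i - a) ^ 2 ≤ 18 * D * n * q + 2 * (∑ i, u i) * a ^ 2 := by
  have h1 := h.small u hu0 hu1 hu
  have h2 : ∑ i, u i * (b i - a) ^ 2 ≤ ∑ i, (2 * (u i * p i ^ 2) + 2 * a ^ 2 * u i) := by
    refine Finset.sum_le_sum fun i _ => ?_
    by_cases hi : i ∈ G
    · rw [hb i hi]
      nlinarith [mul_nonneg (hu0 i) (sq_nonneg (p i + a))]
    · simp [huG i hi]
  rw [Finset.sum_add_distrib, ← Finset.mul_sum, ← Finset.mul_sum] at h2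
  linarith

end Scalar

/-! ### Weighted mean and directional scatter -/

section WeightedMean

variable {n : ℕ} {E κ : Type*} [NormedAddCommGroup E] [InnerProductSpace ℝ E]

/-- The weighted mean of a family of points. -/
noncomputable def weightedMean (w : Fin n → ℝ) (y : Fin n → E) : E :=
  (∑ i, w i)⁻¹ • ∑ i, w i • y i

/-- The weighted sum of squared deviations from the weighted mean in direction `r`. -/
noncomputable def spread (w : Fin n → ℝ) (y : Fin n → E) (r : E) : ℝ :=
  ∑ i, w i * (inner ℝ r (y i - weightedMean w y)) ^ 2

theorem inner_weightedMean_sub (w : Fin n → ℝ) (y : Fin n → E) (hW : ∑ i, w i ≠ 0) (μ r : E) :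
    inner ℝ r (weightedMean w y - μ) * ∑ i, w i = ∑ i, w i * inner ℝ r (y i - μ) := by
  simp only [weightedMean, inner_sub_right, inner_smul_right, inner_sum, mul_sub,
    Finset.sum_sub_distrib, ← Finset.sum_mul]
  field_simp

theorem spread_eq (w : Fin n → ℝ) (y : Fin n → E) (μ r : E) :
    spread w y r = ∑ i, w i * (inner ℝ r (y i - μ) - inner ℝ r (weightedMean w y - μ)) ^ 2 := by
  simp only [spread, ← inner_sub_right, sub_sub_sub_cancel_right]

/-- Lowering weights lowers the second moment about a fixed centre, and the weighted mean is the
centre that minimizes it. Hence a bound on the scatter survives all later rounds. -/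
theorem spread_mono {w w' : Fin n → ℝ} (hw0 : ∀ i, 0 ≤ w' i)
    (hw : ∀ i, w' i ≤ w i) (hW' : ∑ i, w' i ≠ 0)
    (y : Fin n → E) (r : E) : spread w' y r ≤ spread w y r := by
  set μ := weightedMean w y
  have h := inner_weightedMean_sub w' y hW' μ r
  rw [spread_eq w' y μ, spread_eq w y μ]
  set a := inner ℝ r (weightedMean w' y - μ)
  have h1 : ∑ i, w' i * (inner ℝ r (y i - μ) - a) ^ 2 =
      ∑ i, w' i * (inner ℝ r (y i - μ)) ^ 2 - (∑ i, w' i) * a ^ 2 := by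
    have : ∀ i, w' i * (inner ℝ r (y i - μ) - a) ^ 2 =
        w' i * (inner ℝ r (y i - μ)) ^ 2 - 2 * a * (w' i * inner ℝ r (y i - μ)) + a ^ 2 * w' i :=
      fun i => by ring
    simp only [this, Finset.sum_add_distrib, Finset.sum_sub_distrib, ← Finset.mul_sum, ← h]
    ring
  have h2 : ∑ i, w' i * (inner ℝ r (y i - μ)) ^ 2 ≤ ∑ i, w i * (inner ℝ r (y i - μ)) ^ 2 :=
    Finset.sum_le_sum fun i _ => mul_le_mul_of_nonneg_right (hw i) (sq_nonneg _)
  have h3 : 0 ≤ (∑ i, w' i) * a ^ 2 :=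
    mul_nonneg (Finset.sum_nonneg fun i _ => hw0 i) (sq_nonneg _)
  simp only [μ, sub_self, inner_zero_right, sub_zero]
  linarith

end WeightedMean

/-! ### Scores and one filtering step -/

section Filter

variable {n : ℕ} {E κ : Type*} [NormedAddCommGroup E] [InnerProductSpace ℝ E] [Fintype κ]
  {ε D : ℝ} {w : Fin n → ℝ} {G : Finset (Fin n)} {y z : Fin n → E} {μ : E} {V : κ → E}

/-- The data of one round of the filter: the points `y` agree with clean points `z` on the good set
`G`, whose complement is small, and `w` has removed little weight from `G`. -/
structure FilterState (ε D : ℝ) (G : Finset (Fin n)) (y z : Fin n → E) (μ : E)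
    (w : Fin n → ℝ) : Prop where
  n_pos : 0 < n
  eps_pos : 0 < ε
  eps_lt : ε < 1 / 6
  D_nonneg : 0 ≤ D
  clean : ∀ r : E, Clean ε D (‖r‖ ^ 2) fun i => inner ℝ r (z i - μ)
  eq_on_good : ∀ i ∈ G, y i = z i
  card_bad : (Gᶜ.card : ℝ) ≤ ε * n
  nonneg : ∀ i, 0 ≤ w i
  le_one : ∀ i, w i ≤ 1
  good_weight : (1 - 2 * ε) * n ≤ ∑ i ∈ G, w i

theorem FilterState.weight (h : FilterState ε D G y z μ w) : (1 - 2 * ε) * n ≤ ∑ i, w i :=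
  h.good_weight.trans
    (Finset.sum_le_sum_of_subset_of_nonneg (Finset.subset_univ _) fun i _ _ => h.nonneg i)

theorem FilterState.weight_pos (h : FilterState ε D G y z μ w) : 0 < ∑ i, w i := by
  have : (0 : ℝ) < n := by exact_mod_cast h.n_pos
  exact (mul_pos (by linarith [h.eps_lt]) this).trans_le h.weight

variable (V) in
/-- The sum of squared deviations of a point from the weighted mean, along the vectors `V l`. -/
noncomputable def rawScore (w : Fin n → ℝ) (y : Fin n → E) (i : Fin n) : ℝ :=
  ∑ l, (inner ℝ (V l) (y i - weightedMean w y)) ^ 2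

/-- Through this exchange of sums the one-directional estimates for each `V l` add up to estimates
for the scores. -/
theorem sum_rawScore (S : Finset (Fin n)) (u : Fin n → ℝ) (μ : E) :
    ∑ i ∈ S, u i * rawScore V w y i = ∑ l, ∑ i ∈ S,
      u i * (inner ℝ (V l) (y i - μ) - inner ℝ (V l) (weightedMean w y - μ)) ^ 2 := by
  rw [Finset.sum_comm]
  refine Finset.sum_congr rfl fun i _ => ?_
  simp only [rawScore, Finset.mul_sum, ← inner_sub_right, sub_sub_sub_cancel_right]

theorem FilterState.bad_lower (h : FilterState ε D G y z μ w) :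
    2 / 9 * n ^ 2 * ∑ l, (inner ℝ (V l) (weightedMean w y - μ)) ^ 2 -
      60 * ε * D * n ^ 2 * ∑ l, ‖V l‖ ^ 2 ≤ ε * n * ∑ i ∈ Gᶜ, w i * rawScore V w y i := by
  rw [sum_rawScore Gᶜ w μ, Finset.mul_sum, Finset.mul_sum, Finset.mul_sum,
    ← Finset.sum_sub_distrib]
  exact Finset.sum_le_sum fun l _ => (h.clean (V l)).bad_lower h.eps_pos h.eps_lt
    h.nonneg h.le_one (fun i hi => by rw [h.eq_on_good i hi]) h.card_bad
    h.good_weight (inner_weightedMean_sub w y h.weight_pos.ne' μ (V l))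

theorem FilterState.good_upper (h : FilterState ε D G y z μ w) :
    ∑ i ∈ G, w i * rawScore V w y i ≤ (1 + 11 * D) * n * ∑ l, ‖V l‖ ^ 2 +
      2 * n * ∑ l, (inner ℝ (V l) (weightedMean w y - μ)) ^ 2 := by
  rw [sum_rawScore G w μ, Finset.mul_sum, Finset.mul_sum, ← Finset.sum_add_distrib]
  refine Finset.sum_le_sum fun l _ => (h.clean (V l)).good_upper h.eps_pos h.eps_lt h.n_pos
    h.D_nonneg (sq_nonneg _) h.nonneg h.le_one (fun i hi => by rw [h.eq_on_good i hi]) ?_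
  have h1 : 0 ≤ ε * n := mul_nonneg h.eps_pos.le (Nat.cast_nonneg n)
  linarith [h.good_weight]

theorem FilterState.small_upper (h : FilterState ε D G y z μ w) {u : Fin n → ℝ}
    (hu0 : ∀ i, 0 ≤ u i) (hu1 : ∀ i, u i ≤ 1) (huG : ∀ i ∉ G, u i = 0)
    (hu : ∑ i, u i ≤ 3 * ε * n) :
    ∑ i, u i * rawScore V w y i ≤ 18 * D * n * ∑ l, ‖V l‖ ^ 2 +
      2 * (∑ i, u i) * ∑ l, (inner ℝ (V l) (weightedMean w y - μ)) ^ 2 := by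
  rw [sum_rawScore Finset.univ u μ, Finset.mul_sum _ _ (18 * D * n),
    Finset.mul_sum _ _ (2 * ∑ i, u i), ← Finset.sum_add_distrib]
  exact Finset.sum_le_sum fun l _ => (h.clean (V l)).small_upper hu0 hu1
    (fun i hi => by rw [h.eq_on_good i hi]) huG hu

/-- If the second moment along `V` is too large, then the scores above the threshold `T` carry more
bad weight than good weight. -/
theorem FilterState.sum_good_lt_sum_bad (h : FilterState ε D G y z μ w) {f : Fin n → ℝ}
    (hf : ∀ i, w i ≠ 0 → f i = rawScore V w y i) {T : ℝ} (hT0 : 0 ≤ T)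
    (hT : ∑ i, (if f i ≤ T then 0 else w i) ≤ 2 * ε * n)
    (hT' : 2 * ε * n ≤ ∑ i, (if T ≤ f i then w i else 0))
    (hact : (1 + 911 * D) * n * ∑ l, ‖V l‖ ^ 2 < ∑ i, w i * f i) :
    ∑ i ∈ G, w i * (if f i ≤ T then 0 else f i) < ∑ i ∈ Gᶜ, w i * (if f i ≤ T then 0 else f i) := by
  have hn : (0 : ℝ) < n := by exact_mod_cast h.n_pos
  have hε := h.eps_pos
  have hε' := h.eps_lt
  have hD := h.D_nonneg
  have hεn : 0 < ε * n := by positivity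
  have hwf : ∀ i, w i * f i = w i * rawScore V w y i := fun i => by
    by_cases hi : w i = 0
    · simp [hi]
    · rw [hf i hi]
  have hA1 := h.bad_lower (V := V)
  have hA2 := h.good_upper (V := V)
  have hsmall := fun u => h.small_upper (V := V) (u := u)
  set Q := ∑ l, ‖V l‖ ^ 2
  set A := ∑ l, (inner ℝ (V l) (weightedMean w y - μ)) ^ 2
  have hQ : 0 ≤ Q := Finset.sum_nonneg fun l _ => sq_nonneg _
  have hA : 0 ≤ A := Finset.sum_nonneg fun l _ => sq_nonneg _
  simp only [← hwf] at hA1 hA2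
  have hsplit := Finset.sum_add_sum_compl G fun i => w i * f i
  set SB := ∑ i ∈ Gᶜ, w i * f i
  have hDQ : 0 ≤ D * n * Q := by positivity
  -- the good part of the scores above the threshold
  have hgood : ∑ i ∈ G, w i * (if f i ≤ T then 0 else f i) ≤ 18 * D * n * Q + 4 * (ε * n) * A := by
    set u : Fin n → ℝ := fun i => if i ∈ G then (if f i ≤ T then 0 else w i) else 0 with hu
    have hu0 : ∀ i, 0 ≤ u i := fun i => by
      simp only [hu]
      split_ifs <;> simp [h.nonneg i]
    have hule : ∀ i, u i ≤ if f i ≤ T then 0 else w i := fun i => by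
      simp only [hu]
      split_ifs <;> simp [h.nonneg i]
    have hu1 : ∀ i, u i ≤ 1 := fun i => (hule i).trans (by split_ifs <;> simp [h.le_one i])
    have hus : ∑ i, u i ≤ 2 * ε * n := (Finset.sum_le_sum fun i _ => hule i).trans hT
    have := hsmall u hu0 hu1 (fun i hi => by simp [hu, hi]) (by linarith)
    have e : ∑ i ∈ G, w i * (if f i ≤ T then 0 else f i) = ∑ i, u i * rawScore V w y i := by
      simp only [hu, ite_mul, zero_mul, Finset.sum_ite_mem, Finset.univ_inter, mul_ite, mul_zero,
        hwf]
    rw [e]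
    have h2 : (∑ i, u i) * A ≤ 2 * ε * n * A := mul_le_mul_of_nonneg_right hus hA
    linarith
  -- the threshold is not large
  have hbadw := sum_compl_le_card (w := w) h.le_one h.card_bad
  have hTle : T * (ε * n) ≤ 18 * D * n * Q + 2 * (ε * n) * A := by
    set m := ∑ i ∈ G, (if T ≤ f i then w i else 0) with hm
    -- Weight at least 2εn has score at least T, and at most εn of it is bad. The good rest, scaled
    -- down to total exactly εn, is a small fraction in the sense of `small_upper`.
    have hmle : ε * n ≤ m := by
      have h1 := Finset.sum_add_sum_compl G fun i => if T ≤ f i then w i else 0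
      have h2 : ∑ i ∈ Gᶜ, (if T ≤ f i then w i else 0) ≤ ∑ i ∈ Gᶜ, w i :=
        Finset.sum_le_sum fun i _ => by split_ifs <;> simp [h.nonneg i]
      linarith
    have hm0 : 0 < m := hεn.trans_le hmle
    set c := ε * n / m with hc
    have hc0 : 0 ≤ c := by positivity
    have hc1 : c ≤ 1 := (div_le_one hm0).2 hmle
    set u : Fin n → ℝ := fun i => if i ∈ G then c * (if T ≤ f i then w i else 0) else 0 with hu
    have hu0 : ∀ i, 0 ≤ u i := fun i => by
      simp only [hu]
      split_ifs <;> simp [mul_nonneg hc0 (h.nonneg i)]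
    have hu1 : ∀ i, u i ≤ 1 := fun i => by
      simp only [hu]
      split_ifs <;> simp [mul_le_one₀ hc1 (h.nonneg i) (h.le_one i)]
    have hus : ∑ i, u i = ε * n := by
      simp only [hu, Finset.sum_ite_mem, Finset.univ_inter, ← Finset.mul_sum]
      rw [← hm, hc]
      field_simp
    have h1 := hsmall u hu0 hu1 (fun i hi => by simp [hu, hi]) (by linarith)
    rw [hus] at h1
    refine le_trans ?_ h1
    rw [← hus, mul_comm, Finset.sum_mul]
    refine Finset.sum_le_sum fun i _ => ?_
    by_cases hi : w i = 0
    · simp [hu, hi]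
    · by_cases hTi : T ≤ f i
      · rw [← hf i hi]
        exact mul_le_mul_of_nonneg_left hTi (hu0 i)
      · simp [hu, hTi]
  -- the bad part of the scores above the threshold
  have hbad : SB - T * (ε * n) ≤ ∑ i ∈ Gᶜ, w i * (if f i ≤ T then 0 else f i) := by
    have h1 : SB ≤ ∑ i ∈ Gᶜ, (w i * (if f i ≤ T then 0 else f i) + T * w i) := by
      refine Finset.sum_le_sum fun i _ => ?_
      have := h.nonneg i
      split_ifs with hi
      · nlinarith
      · nlinarith [mul_nonneg hT0 this]
    rw [Finset.sum_add_distrib, ← Finset.mul_sum] at h1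
    have h2 : T * ∑ i ∈ Gᶜ, w i ≤ T * (ε * n) := mul_le_mul_of_nonneg_left hbadw hT0
    linarith
  -- combination
  have hA1' : 2 / 9 * (n * A) ≤ ε * (SB + 60 * (D * n * Q)) := by
    have : n * (2 / 9 * (n * A)) ≤ n * (ε * (SB + 60 * (D * n * Q))) := by linarith
    exact le_of_mul_le_mul_left this hn
  have hnA : 0 ≤ n * A := by positivity
  have hX : 0 ≤ SB + 60 * (D * n * Q) := by
    by_contra hneg
    push Not at hneg
    nlinarith
  have h1 : n * A ≤ 3 / 4 * (SB + 60 * (D * n * Q)) := by nlinarith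
  have h2 : ε * n * A ≤ 1 / 8 * (SB + 60 * (D * n * Q)) := by
    have : ε * (n * A) ≤ 1 / 6 * (n * A) := mul_le_mul_of_nonneg_right hε'.le hnA
    linarith
  -- It suffices that SB > 36DnQ + 6εnA, which by the bound on A follows from SB > 324DnQ. The
  -- hypothesis gives SB > 900DnQ - 2nA, hence (5/2)SB > 810DnQ, which is exactly this; here 911 =
  -- 900 + 11.
  linarith

/-- The weights after one round of the filter remain balanced. -/
theorem FilterState.downweight (h : FilterState ε D G y z μ w) {f : Fin n → ℝ}
    (hf0 : ∀ i, 0 ≤ f i)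
    (hf : ∀ i, w i ≠ 0 → f i = rawScore V w y i) {T F : ℝ} (hT0 : 0 ≤ T)
    (hT : ∑ i, (if f i ≤ T then 0 else w i) ≤ 2 * ε * n)
    (hT' : 2 * ε * n ≤ ∑ i, (if T ≤ f i then w i else 0))
    (hact : (1 + 911 * D) * n * ∑ l, ‖V l‖ ^ 2 < ∑ i, w i * f i)
    (hF : ∀ i, f i ≤ F) (hbal : ∑ i ∈ G, (1 - w i) ≤ ∑ i ∈ Gᶜ, (1 - w i)) {w' : Fin n → ℝ}
    (hw' : ∀ i, w' i = if f i ≤ T then w i else w i * (1 - f i / F)) :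
    T < F ∧ 0 < F ∧ ∑ i ∈ G, (1 - w' i) ≤ ∑ i ∈ Gᶜ, (1 - w' i) := by
  have key := h.sum_good_lt_sum_bad hf hT0 hT hT' hact
  have hg0 : 0 ≤ ∑ i ∈ G, w i * (if f i ≤ T then 0 else f i) :=
    Finset.sum_nonneg fun i _ => mul_nonneg (h.nonneg i) (by split_ifs <;> simp [hf0 i])
  obtain ⟨i, -, hi⟩ := Finset.exists_lt_of_sum_lt (s := Gᶜ) (f := fun _ => (0 : ℝ))
    (g := fun i => w i * (if f i ≤ T then 0 else f i)) (by
    rw [Finset.sum_const_zero]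
    exact hg0.trans_lt key)
  have hTi : T < f i := by
    by_contra hle
    simp [not_lt.1 hle] at hi
  have hTF : T < F := hTi.trans_le (hF i)
  have hF0 : 0 < F := hT0.trans_lt hTF
  refine ⟨hTF, hF0, ?_⟩
  -- The weight newly removed is the truncated weighted score over F, so `key` divided by F compares
  -- the removed weights.
  have e : ∀ i, 1 - w' i = (1 - w i) + (w i * (if f i ≤ T then 0 else f i)) / F := fun i => by
    rw [hw']
    split_ifs
    · simp
    · ring
  simp only [e, Finset.sum_add_distrib, ← Finset.sum_div]
  have := div_le_div_of_nonneg_right key.le hF0.le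
  linarith

end Filter

/-! ### Trace powers in place of eigenvalues -/

section Power

/-- Log-convex sequences grow at least geometrically. -/
theorem geometric_le_of_logConvex {b : ℕ → ℝ} (hb : ∀ j, 0 ≤ b j)
    (hlog : ∀ j, b (j + 1) ^ 2 ≤ b j * b (j + 2)) {s : ℝ} (hs : 0 ≤ s) (h : s * b 0 ≤ b 1)
    (m : ℕ) : s ^ m * b 0 ≤ b m := by
  have hstep : ∀ j, s * b j ≤ b (j + 1) := by
    intro j
    induction j with
    | zero => exact h
    | succ j ih =>
      rcases (hb j).eq_or_lt with h0 | h0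
      · have : b (j + 1) = 0 := by
          have := hlog j
          rw [← h0, zero_mul] at this
          exact pow_eq_zero_iff two_ne_zero |>.1 (le_antisymm this (sq_nonneg _))
        rw [this, mul_zero]
        exact hb _
      · refine le_of_mul_le_mul_left ?_ h0
        have := mul_le_mul_of_nonneg_right ih (hb (j + 1))
        linarith [hlog j]
  induction m with
  | zero => simp
  | succ m ih =>
    calc s ^ (m + 1) * b 0 = s * (s ^ m * b 0) := by ring
      _ ≤ s * b m := mul_le_mul_of_nonneg_left ih hs
      _ ≤ _ := hstep m

/-- A bound on a ratio of a log-convex sequence bounds all earlier growth. -/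
theorem le_geometric_of_logConvex {b : ℕ → ℝ} (hb : ∀ j, 0 ≤ b j)
    (hlog : ∀ j, b (j + 1) ^ 2 ≤ b j * b (j + 2)) {s : ℝ} (hs : 0 ≤ s) :
    ∀ m, b (m + 1) ≤ s * b m → b m ≤ s ^ m * b 0 := by
  intro m
  induction m with
  | zero => simp
  | succ m ih =>
    intro h
    have hprev : b (m + 1) ≤ s * b m := by
      rcases (hb (m + 1)).eq_or_lt with h0 | h0
      · rw [← h0]
        exact mul_nonneg hs (hb m)
      · refine le_of_mul_le_mul_right ?_ h0
        have := mul_le_mul_of_nonneg_left h (hb m)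
        linarith [hlog m]
    calc b (m + 1) ≤ s * b m := hprev
      _ ≤ s * (s ^ m * b 0) := mul_le_mul_of_nonneg_left (ih hprev) hs
      _ = _ := by ring

open Matrix

variable {d : ℕ} {M : Matrix (Fin d) (Fin d) ℝ}

/-- Moments of a positive semidefinite matrix under a positive functional are log-convex. -/
theorem Matrix.PosSemidef.logConvex (hM : M.PosSemidef)
    (φ : Matrix (Fin d) (Fin d) ℝ →ₗ[ℝ] ℝ) (hφ : ∀ A, A.PosSemidef → 0 ≤ φ A) (j : ℕ) :
    φ (M ^ (j + 1)) ^ 2 ≤ φ (M ^ j) * φ (M ^ (j + 2)) := by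
  -- This is φ of the positive semidefinite matrix (t + M) M^j (t + M); the claim is that the
  -- discriminant in t is nonpositive.
  have h : ∀ t : ℝ, 0 ≤ φ (M ^ j) * (t * t) + 2 * φ (M ^ (j + 1)) * t + φ (M ^ (j + 2)) := by
    intro t
    have hH : (t • (1 : Matrix (Fin d) (Fin d) ℝ) + M)ᴴ = t • 1 + M := by
      rw [conjTranspose_add, conjTranspose_smul, conjTranspose_one, hM.1.eq]
      simp
    have := hφ _ ((hM.pow j).conjTranspose_mul_mul_same (t • 1 + M))
    rw [hH] at this
    have e : (t • (1 : Matrix (Fin d) (Fin d) ℝ) + M) * M ^ j * (t • 1 + M) =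
        (t * t) • M ^ j + (2 * t) • M ^ (j + 1) + M ^ (j + 2) := by
      have h1 : M * M ^ j = M ^ (j + 1) := (pow_succ' M j).symm
      have h2 : M ^ j * M = M ^ (j + 1) := (pow_succ M j).symm
      have h3 : M ^ (j + 1) * M = M ^ (j + 2) := (pow_succ M (j + 1)).symm
      simp only [add_mul, mul_add, smul_mul_assoc, mul_smul_comm, one_mul, mul_one, h1, h2, h3]
      module
    rw [e] at this
    simp only [map_add, map_smul, smul_eq_mul] at this
    linarith
  have := discrim_le_zero h
  rw [discrim] at this
  linarith

/-- The quadratic form at `x` as a functional of the matrix. -/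
def quadFunctional (x : Fin d → ℝ) : Matrix (Fin d) (Fin d) ℝ →ₗ[ℝ] ℝ where
  toFun A := x ⬝ᵥ A *ᵥ x
  map_add' A B := by rw [add_mulVec, dotProduct_add]
  map_smul' c A := by rw [smul_mulVec, dotProduct_smul]; rfl

/-- If the ratio of traces of consecutive high powers of a positive semidefinite matrix is at most
`s`, then its quadratic form exceeds `s` only slightly. -/
theorem Matrix.PosSemidef.quad_le_of_trace_pow (hM : M.PosSemidef) {m : ℕ} {s η : ℝ} (hs : 0 ≤ s)
    (hη : 0 ≤ η) (hm : 0 < m) (hd : (d : ℝ) ≤ (1 + η) ^ (m + m))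
    (h : (M ^ (m + m + 1)).trace ≤ s * (M ^ (m + m)).trace) (x : Fin d → ℝ) :
    x ⬝ᵥ M *ᵥ x ≤ s * (1 + η) * (x ⬝ᵥ x) := by
  have htr : ∀ A : Matrix (Fin d) (Fin d) ℝ, A.PosSemidef → 0 ≤ traceLinearMap (Fin d) ℝ ℝ A :=
    fun A hA => hA.trace_nonneg
  have hquad : ∀ A : Matrix (Fin d) (Fin d) ℝ, A.PosSemidef → 0 ≤ quadFunctional x A :=
    fun A hA => by simpa [quadFunctional] using hA.dotProduct_mulVec_nonneg x
  -- Ratios of consecutive traces increase, so the bound s on the last one yields tr M^(2m) ≤ s^(2m)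
  -- d.
  have h1 := le_geometric_of_logConvex (b := fun j => traceLinearMap (Fin d) ℝ ℝ (M ^ j))
    (fun j => htr _ (hM.pow j)) (hM.logConvex _ htr) hs (m + m) h
  simp only [traceLinearMap_apply, pow_zero, trace_one, Fintype.card_fin] at h1
  have hxx : 0 ≤ x ⬝ᵥ x := by simpa using dotProduct_star_self_nonneg x
  rcases hxx.eq_or_lt with h0 | h0
  · have : x = 0 := by
      rw [← dotProduct_self_eq_zero (v := x)]
      exact h0.symm
    simp [this]
  set q := (x ⬝ᵥ M *ᵥ x) / (x ⬝ᵥ x) with hq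
  have hMx : 0 ≤ x ⬝ᵥ M *ᵥ x := hquad M hM
  have hq0 : 0 ≤ q := div_nonneg hMx h0.le
  -- For the moments at x the first ratio is the Rayleigh quotient q, whence the moment of order 2m
  -- is at least q^(2m) times |x|².
  have h2 := geometric_le_of_logConvex (b := fun j => quadFunctional x (M ^ j))
    (fun j => hquad _ (hM.pow j)) (hM.logConvex _ hquad) hq0 (by
      simp only [quadFunctional, LinearMap.coe_mk, AddHom.coe_mk, pow_zero, pow_one, one_mulVec]
      rw [hq, div_mul_cancel₀ _ h0.ne']) (m + m)
  simp only [quadFunctional, LinearMap.coe_mk, AddHom.coe_mk, pow_zero, one_mulVec] at h2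
  have hsymm : (M ^ m)ᵀ = M ^ m := by simpa using (hM.pow m).1.eq
  -- With B = M^m this compares |Bx|² with the squared Frobenius norm of B, by Cauchy–Schwarz in
  -- each row.
  have h3 : x ⬝ᵥ M ^ (m + m) *ᵥ x ≤ (M ^ (m + m)).trace * (x ⬝ᵥ x) := by
    rw [pow_add]
    nth_rewrite 1 3 [← hsymm]
    set B := M ^ m
    have e1 : x ⬝ᵥ (Bᵀ * B) *ᵥ x = ∑ l, (∑ j, B l j * x j) ^ 2 := by
      rw [← mulVec_mulVec, dotProduct_mulVec, vecMul_transpose]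
      simp only [dotProduct, mulVec, sq]
    have e2 : (Bᵀ * B).trace = ∑ l, ∑ j, B l j ^ 2 := by
      rw [Finset.sum_comm]
      simp only [trace, diag_apply, mul_apply, transpose_apply, sq]
    have e3 : x ⬝ᵥ x = ∑ j, x j ^ 2 := by simp only [dotProduct, sq]
    rw [e1, e2, e3, Finset.sum_mul]
    exact Finset.sum_le_sum fun l _ => Finset.sum_mul_sq_le_sq_mul_sq _ _ _
  have h4 : q ^ (m + m) ≤ (s * (1 + η)) ^ (m + m) := by
    refine le_of_mul_le_mul_right ?_ h0
    calc q ^ (m + m) * (x ⬝ᵥ x) ≤ (M ^ (m + m)).trace * (x ⬝ᵥ x) := h2.trans h3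
      _ ≤ s ^ (m + m) * d * (x ⬝ᵥ x) := mul_le_mul_of_nonneg_right h1 h0.le
      _ ≤ s ^ (m + m) * (1 + η) ^ (m + m) * (x ⬝ᵥ x) := by gcongr
      _ = _ := by rw [mul_pow]
  have h5 : q ≤ s * (1 + η) :=
    (pow_le_pow_iff_left₀ hq0 (by positivity) (by omega)).1 h4
  rwa [hq, div_le_iff₀ h0] at h5

end Power

open Matrix

/-! ### The scatter matrix -/

section Scatter

variable {d n : ℕ}

theorem inner_toLp (a : Fin d → ℝ) (x : EuclideanSpace ℝ (Fin d)) :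
    inner ℝ (WithLp.toLp 2 a) x = ∑ j, a j * x j := by
  simp [PiLp.inner_apply, mul_comm]

/-- The rows of a matrix as Euclidean vectors. -/
noncomputable def rowVectors (V : Matrix (Fin d) (Fin d) ℝ) (l : Fin d) :
    EuclideanSpace ℝ (Fin d) :=
  WithLp.toLp 2 (V l)

/-- The weighted scatter matrix of a family of points about its weighted mean. -/
noncomputable def scatter (w : Fin n → ℝ) (y : Fin n → EuclideanSpace ℝ (Fin d)) :
    Matrix (Fin d) (Fin d) ℝ :=
  of fun a b => ∑ i, w i * ((y i a - weightedMean w y a) * (y i b - weightedMean w y b))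

theorem dotProduct_scatter_mulVec (w : Fin n → ℝ) (y : Fin n → EuclideanSpace ℝ (Fin d))
    (a : Fin d → ℝ) : a ⬝ᵥ scatter w y *ᵥ a = spread w y (WithLp.toLp 2 a) := by
  simp only [spread, inner_toLp, dotProduct, mulVec, scatter, of_apply, PiLp.sub_apply,
    Finset.mul_sum, Finset.sum_mul, sq]
  rw [Finset.sum_comm]
  conv_lhs =>
    enter [2, b]
    rw [Finset.sum_comm]
  rw [Finset.sum_comm]
  refine Finset.sum_congr rfl fun i _ => Finset.sum_congr rfl fun b _ =>
    Finset.sum_congr rfl fun c _ => by ring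

theorem spread_nonneg {w : Fin n → ℝ} (hw : ∀ i, 0 ≤ w i)
    (y : Fin n → EuclideanSpace ℝ (Fin d)) (r : EuclideanSpace ℝ (Fin d)) : 0 ≤ spread w y r :=
  Finset.sum_nonneg fun i _ => mul_nonneg (hw i) (sq_nonneg _)

theorem posSemidef_scatter {w : Fin n → ℝ} (hw : ∀ i, 0 ≤ w i)
    (y : Fin n → EuclideanSpace ℝ (Fin d)) : (scatter w y).PosSemidef := by
  refine .of_dotProduct_mulVec_nonneg ?_ fun x => ?_
  · ext a b
    simp only [conjTranspose_apply, scatter, of_apply, star_trivial]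
    exact Finset.sum_congr rfl fun i _ => by ring
  · rw [star_trivial, dotProduct_scatter_mulVec]
    exact spread_nonneg hw y _

/-- For V = M^m with M the scatter matrix this is tr M^(2m+1), while the squared row norms sum to tr
M^(2m): the filter's activity condition is a condition on the ratio of traces. -/
theorem sum_mul_rawScore_rowVectors (w : Fin n → ℝ) (y : Fin n → EuclideanSpace ℝ (Fin d))
    (V : Matrix (Fin d) (Fin d) ℝ) :
    ∑ i, w i * rawScore (rowVectors V) w y i = (V * scatter w y * Vᵀ).trace := by
  have h : ∀ l, (V * scatter w y * Vᵀ) l l = spread w y (rowVectors V l) := fun l => by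
    rw [rowVectors, ← dotProduct_scatter_mulVec, mul_assoc, mul_apply_eq_vecMul]
    simp only [dotProduct, mulVec, vecMul, mul_apply, transpose_apply]
  simp only [trace, diag_apply, h, spread, rawScore, Finset.mul_sum]
  exact Finset.sum_comm

theorem sum_norm_rowVectors_sq (V : Matrix (Fin d) (Fin d) ℝ) :
    ∑ l, ‖rowVectors V l‖ ^ 2 = (V * Vᵀ).trace := by
  simp only [trace, diag_apply, mul_apply, transpose_apply, ← sq]
  exact Finset.sum_congr rfl fun l _ => by
    simp [EuclideanSpace.norm_sq_eq, rowVectors]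

end Scatter

/-! ### The invariant of the rounds -/

section Round

variable {d n : ℕ} {ε D : ℝ} {y z : Fin n → EuclideanSpace ℝ (Fin d)} {w w' : Fin n → ℝ}
  {μ : EuclideanSpace ℝ (Fin d)} {G : Finset (Fin n)}

/-- One round of the filter, from the weights `w` to the weights `w'`: points are scored by the
power `d * n` of the scatter matrix, the scores above a threshold lead to a reduction of
weight, and the reduced weights are accepted if enough weight remains. -/
def IsRound (ε : ℝ) (y : Fin n → EuclideanSpace ℝ (Fin d)) (w w' : Fin n → ℝ) : Prop :=
  ∃ (f v : Fin n → ℝ) (F T : ℝ),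
    (∀ i, f i = if w i ≤ 0 then 0 else rawScore (rowVectors (scatter w y ^ (d * n))) w y i) ∧
    (∀ i, f i ≤ F) ∧ 0 ≤ F ∧ (F = 0 ∨ ∃ i, F = f i) ∧
    (T = F ∨ ∃ j, T = f j ∧ ∑ i, (if f i ≤ f j then 0 else w i) ≤ 2 * ε * n) ∧
    (∀ j, ∑ i, (if f i ≤ f j then 0 else w i) ≤ 2 * ε * n → T ≤ f j) ∧
    (∀ i, v i = if f i ≤ T then w i else w i * (1 - f i / F)) ∧
    ∀ i, w' i = if 1 ≤ ε * n then (if (1 - 2 * ε) * n ≤ ∑ i, v i then v i else w i) else w i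

/-- The invariant of the filter after `k` rounds: either the scatter is small in all directions,
or at least as much bad as good weight has been removed, and `k` points are gone. -/
structure RoundInvariant (ε D : ℝ) (G : Finset (Fin n)) (y : Fin n → EuclideanSpace ℝ (Fin d))
    (k : ℕ) (w : Fin n → ℝ) : Prop where
  nonneg : ∀ i, 0 ≤ w i
  le_one : ∀ i, w i ≤ 1
  weight : (1 - 2 * ε) * n ≤ ∑ i, w i
  alternative : (∀ r, spread w y r ≤ (1 + 1823 * D) * n * ‖r‖ ^ 2) ∨
    (∑ i ∈ G, (1 - w i) ≤ ∑ i ∈ Gᶜ, (1 - w i) ∧ k ≤ (Finset.univ.filter fun i => w i = 0).card)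

/-- The removed good weight is at most the removed bad weight, which is at most |Gᶜ| ≤ εn. -/
theorem good_weight_of_balanced (hB : (Gᶜ.card : ℝ) ≤ ε * n) (hw0 : ∀ i, 0 ≤ w i)
    (hbal : ∑ i ∈ G, (1 - w i) ≤ ∑ i ∈ Gᶜ, (1 - w i)) :
    (1 - 2 * ε) * n ≤ ∑ i ∈ G, w i := by
  have h1 : ∑ i ∈ Gᶜ, (1 - w i) ≤ Gᶜ.card := by
    refine (Finset.sum_le_card_nsmul Gᶜ _ 1 fun i _ => by linarith [hw0 i]).trans ?_
    simp
  have h2 : (G.card : ℝ) + Gᶜ.card = n := by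
    have := Finset.card_add_card_compl G
    rw [Fintype.card_fin] at this
    exact_mod_cast this
  rw [Finset.sum_sub_distrib, Finset.sum_const, nsmul_eq_mul, mul_one] at hbal
  linarith

/-- By Bernoulli, (1 + 1/n)^(2dn) ≥ 1 + 2d ≥ d. The factor 1 + 1/n adds 1 + 911D ≤ 912Dn because 1 ≤
εn ≤ Dn; hence 1823 = 911 + 912. -/
theorem spread_le_of_inactive (hd : 0 < d) (hn : 0 < n) (hD : 3 * ε ≤ D) (hε : 0 < ε)
    (hεn : 1 ≤ ε * n) (hw0 : ∀ i, 0 ≤ w i)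
    (h : ∑ i, w i * rawScore (rowVectors (scatter w y ^ (d * n))) w y i ≤
      (1 + 911 * D) * n * ∑ l, ‖rowVectors (scatter w y ^ (d * n)) l‖ ^ 2)
    (r : EuclideanSpace ℝ (Fin d)) : spread w y r ≤ (1 + 1823 * D) * n * ‖r‖ ^ 2 := by
  have hM := posSemidef_scatter hw0 y
  have hn' : (0 : ℝ) < n := by exact_mod_cast hn
  have hV : (scatter w y ^ (d * n))ᵀ = scatter w y ^ (d * n) := by
    simpa using (hM.pow (d * n)).1.eq
  rw [sum_mul_rawScore_rowVectors, sum_norm_rowVectors_sq, hV, ← pow_add, ← pow_succ,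
    ← pow_add, show d * n + 1 + d * n = d * n + d * n + 1 by ring] at h
  have hη : (0 : ℝ) ≤ 1 / n := by positivity
  have hB := one_add_mul_le_pow (a := 1 / (n : ℝ)) (by linarith) (d * n + d * n)
  have key := hM.quad_le_of_trace_pow (m := d * n) (s := (1 + 911 * D) * n) (η := 1 / n)
    (by have : 0 ≤ D := by linarith
        positivity) hη (Nat.mul_pos hd hn) (by
      refine le_trans ?_ hB
      have : ((d * n + d * n : ℕ) : ℝ) * (1 / n) = 2 * d := by
        push_cast
        field_simp
        ring
      rw [this]
      have : (0 : ℝ) ≤ d := Nat.cast_nonneg d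
      linarith) h (WithLp.ofLp r)
  rw [dotProduct_scatter_mulVec, WithLp.toLp_ofLp] at key
  have hr : WithLp.ofLp r ⬝ᵥ WithLp.ofLp r = ‖r‖ ^ 2 := by
    rw [EuclideanSpace.norm_sq_eq]
    simp only [dotProduct, Real.norm_eq_abs, sq_abs, ← sq]
  rw [hr] at key
  refine key.trans (mul_le_mul_of_nonneg_right ?_ (sq_nonneg _))
  have e : (1 + 911 * D) * n * (1 + 1 / n) = (1 + 911 * D) * n + (1 + 911 * D) := by
    field_simp
  rw [e]
  have h1 : (1 : ℝ) ≤ n := by exact_mod_cast hn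
  have h2 : 3 * ε * n ≤ D * n := mul_le_mul_of_nonneg_right hD hn'.le
  have h3 : D * 1 ≤ D * n := mul_le_mul_of_nonneg_left h1 (by linarith)
  linarith

/-- Small scatter persists by monotonicity and is certified by an inactive round. An active round
keeps the balance, which makes its weights pass the acceptance test, and annihilates a further
point. -/
theorem IsRound.invariant (hr : IsRound ε y w w') (hd : 0 < d) (hn : 0 < n) (hε : 0 < ε)
    (hε' : ε < 1 / 6) (hD : 3 * ε ≤ D) (hεn : 1 ≤ ε * n)
    (hclean : ∀ r : EuclideanSpace ℝ (Fin d), Clean ε D (‖r‖ ^ 2) fun i => inner ℝ r (z i - μ))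
    (hG : ∀ i ∈ G, y i = z i) (hB : (Gᶜ.card : ℝ) ≤ ε * n) {k : ℕ}
    (h : RoundInvariant ε D G y k w) : RoundInvariant ε D G y (k + 1) w' := by
  obtain ⟨f, v, F, T, hf, hF, hF0, hFa, hT, hTmin, hv, hw'⟩ := hr
  have hn' : (0 : ℝ) < n := by exact_mod_cast hn
  simp only [if_pos hεn] at hw'
  have hf0 : ∀ i, 0 ≤ f i := fun i => by
    rw [hf]
    split_ifs
    · exact le_rfl
    · exact Finset.sum_nonneg fun l _ => sq_nonneg _
  have hfraw : ∀ i, w i ≠ 0 → f i = rawScore (rowVectors (scatter w y ^ (d * n))) w y i :=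
    fun i hi => by
      rw [hf, if_neg]
      exact not_le.2 ((h.nonneg i).lt_of_ne' hi)
  have hvw : ∀ i, 0 ≤ v i ∧ v i ≤ w i := fun i => by
    rw [hv]
    split_ifs
    · exact ⟨h.nonneg i, le_rfl⟩
    · have h1 : f i / F ≤ 1 := div_le_one_of_le₀ (hF i) hF0
      have h2 : 0 ≤ f i / F := div_nonneg (hf0 i) hF0
      exact ⟨mul_nonneg (h.nonneg i) (by linarith),
        mul_le_of_le_one_right (h.nonneg i) (by linarith)⟩
  have hw'w : ∀ i, 0 ≤ w' i ∧ w' i ≤ w i := fun i => by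
    rw [hw']
    split_ifs
    · exact hvw i
    · exact ⟨h.nonneg i, le_rfl⟩
  have hweight : (1 - 2 * ε) * n ≤ ∑ i, w' i := by
    by_cases hacc : (1 - 2 * ε) * n ≤ ∑ i, v i
    · simp only [hw', if_pos hacc]
      exact hacc
    · simp only [hw', if_neg hacc]
      exact h.weight
  have hpos : 0 < (1 - 2 * ε) * n := mul_pos (by linarith) hn'
  refine ⟨fun i => (hw'w i).1, fun i => (hw'w i).2.trans (h.le_one i), hweight, ?_⟩
  have hcert : (∀ r, spread w y r ≤ (1 + 1823 * D) * n * ‖r‖ ^ 2) →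
      ∀ r, spread w' y r ≤ (1 + 1823 * D) * n * ‖r‖ ^ 2 := fun hs r =>
    (spread_mono (fun i => (hw'w i).1) (fun i => (hw'w i).2) (hpos.trans_le hweight).ne' y r).trans
      (hs r)
  rcases h.alternative with hs | ⟨hbal, hk⟩
  · exact .inl (hcert hs)
  by_cases hact : ∑ i, w i * rawScore (rowVectors (scatter w y ^ (d * n))) w y i ≤
      (1 + 911 * D) * n * ∑ l, ‖rowVectors (scatter w y ^ (d * n)) l‖ ^ 2
  · exact .inl (hcert (spread_le_of_inactive hd hn hD hε hεn h.nonneg hact))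
  right
  have hst : FilterState ε D G y z μ w := ⟨hn, hε, hε', by linarith, hclean, hG, hB, h.nonneg,
    h.le_one, good_weight_of_balanced hB h.nonneg hbal⟩
  have hT0 : 0 ≤ T := by
    rcases hT with rfl | ⟨j, rfl, -⟩
    · exact hF0
    · exact hf0 j
  have hTm : ∑ i, (if f i ≤ T then 0 else w i) ≤ 2 * ε * n := by
    rcases hT with rfl | ⟨j, rfl, hj⟩
    · simp only [hF, if_true, Finset.sum_const_zero]
      positivity
    · exact hj
  -- By minimality of T, the largest score below T has mass more than 2εn above it, and all that
  -- mass scores at least T. If no score lies below T, the total weight suffices.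
  have hTm' : 2 * ε * n ≤ ∑ i, (if T ≤ f i then w i else 0) := by
    by_cases hall : ∀ i, T ≤ f i
    · simp only [hall, if_true]
      exact le_trans (mul_le_mul_of_nonneg_right (by linarith) hn'.le) h.weight
    · push Not at hall
      obtain ⟨j, hj, hmax⟩ := Finset.exists_max_image (Finset.univ.filter fun i => f i < T) f
        (by obtain ⟨i, hi⟩ := hall; exact ⟨i, by simpa using hi⟩)
      have hjT : f j < T := by simpa using hj
      have hlt : 2 * ε * n < ∑ i, (if f i ≤ f j then 0 else w i) := by
        by_contra hle
        exact absurd (hTmin j (not_lt.1 hle)) (not_le.2 hjT)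
      refine hlt.le.trans (Finset.sum_le_sum fun i _ => ?_)
      by_cases hi : f i ≤ f j
      · rw [if_pos hi]
        split_ifs
        · exact h.nonneg i
        · exact le_rfl
      · have : T ≤ f i := by
          by_contra hlt'
          exact hi (hmax i (by simpa using hlt'))
        rw [if_neg hi, if_pos this]
  have hact' : (1 + 911 * D) * n * ∑ l, ‖rowVectors (scatter w y ^ (d * n)) l‖ ^ 2 <
      ∑ i, w i * f i := by
    rw [not_le] at hact
    refine hact.trans_le (le_of_eq (Finset.sum_congr rfl fun i _ => ?_))
    by_cases hi : w i = 0
    · simp [hi]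
    · rw [hfraw i hi]
  obtain ⟨hTF, hFpos, hbal'⟩ :=
    hst.downweight hf0 hfraw hT0 hTm hTm' hact' hF hbal hv
  have hacc : (1 - 2 * ε) * n ≤ ∑ i, v i :=
    (good_weight_of_balanced hB (fun i => (hvw i).1) hbal').trans
      (Finset.sum_le_sum_of_subset_of_nonneg (Finset.subset_univ _) fun i _ _ => (hvw i).1)
  have hw'v : w' = v := funext fun i => by rw [hw', if_pos hacc]
  rw [hw'v]
  refine ⟨hbal', hk.trans_lt ?_⟩
  -- A point of maximal score gets the factor 1 - F/F = 0. It had positive weight before, because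
  -- weightless points score 0 < F.
  obtain ⟨i, hi⟩ := hFa.resolve_left hFpos.ne'
  refine Finset.card_lt_card (Finset.ssubset_iff_of_subset ?_ |>.2 ⟨i, ?_, ?_⟩)
  · intro j
    simp only [Finset.mem_filter, Finset.mem_univ, true_and]
    intro hj
    exact le_antisymm ((hvw j).2.trans hj.le) (hvw j).1
  · rw [Finset.mem_filter, hv, if_neg (by rw [← hi]; exact not_le.2 hTF), ← hi,
      div_self hFpos.ne']
    simp
  · simp only [Finset.mem_filter, Finset.mem_univ, true_and]
    intro hwi
    rw [hf, if_pos hwi.le] at hi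
    exact hFpos.ne' hi

/-- After n rounds the balanced alternative would make every weight zero, so the scatter is small.
The mean error itself is taken as the direction; 9(1823 + 70) = 3 · 5679. -/
theorem RoundInvariant.norm_sub_le (h : RoundInvariant ε D G y n w) (hn : 0 < n) (hε : 0 < ε)
    (hε' : ε < 1 / 6) (hD : 3 * ε ≤ D)
    (hclean : ∀ r : EuclideanSpace ℝ (Fin d), Clean ε D (‖r‖ ^ 2) fun i => inner ℝ r (z i - μ))
    (hG : ∀ i ∈ G, y i = z i) (hB : (Gᶜ.card : ℝ) ≤ ε * n) :
    ‖weightedMean w y - μ‖ ^ 2 ≤ 5679 * (3 * ε * D) := by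
  have hn' : (0 : ℝ) < n := by exact_mod_cast hn
  have hpos : 0 < ∑ i, w i := (mul_pos (by linarith) hn').trans_le h.weight
  have hs : ∀ r, spread w y r ≤ (1 + 1823 * D) * n * ‖r‖ ^ 2 := by
    refine h.alternative.resolve_right ?_
    rintro ⟨-, hk⟩
    have : (Finset.univ.filter fun i => w i = 0) = Finset.univ :=
      Finset.eq_univ_of_card _ (le_antisymm (Finset.card_le_univ _) (by simpa using hk))
    have hz : ∀ i, w i = 0 := fun i => by
      have := this ▸ Finset.mem_univ i
      simpa using this
    simp [hz] at hpos
  set r := weightedMean w y - μ with hr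
  have key := (hclean r).mean_sq_le (a := inner ℝ r (weightedMean w y - μ)) (K := 1823) hε hε' hn
    h.nonneg h.le_one (b := fun i => inner ℝ r (y i - μ))
    (fun i hi => by rw [hG i hi]) hB h.weight (inner_weightedMean_sub w y hpos.ne' μ r)
    (by rw [← spread_eq]; exact hs r)
  rw [← hr, real_inner_self_eq_norm_sq] at key
  rcases (norm_nonneg r).eq_or_lt with h0 | h0
  · rw [← h0, zero_pow two_ne_zero]
    have : 0 ≤ D := by linarith
    positivity
  · refine le_of_mul_le_mul_right ?_ (pow_pos h0 2)
    linarith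

end Round

/-! ### The filter as a program -/

namespace RealRAM

theorem Evaluable.of_eq {L : ℕ} {F G : Store → ℝ} (h : Evaluable L F) (e : ∀ s, F s = G s) :
    Evaluable L G := by
  obtain rfl : F = G := funext e
  exact h

theorem Evaluable.max {L : ℕ} {F : Store → ℝ} (hL : 6 ≤ L) (b : Bound)
    (hF : Evaluable (L + 1) F) : Evaluable L fun s =>
      foldUpTo Max.max (fun x => F (s.setIndex L x)) (b.val (s.index 0) (s.index 1)) :=
  hF.fold hL isPrimitive_max b

/-- The fold starts from 0, hence the extra alternative; it does no harm for the scores and gaps,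
which are nonnegative. -/
theorem foldUpTo_max (g : ℕ → ℝ) (N : ℕ) :
    (∀ x < N, g x ≤ foldUpTo max g N) ∧ 0 ≤ foldUpTo max g N ∧
      (foldUpTo max g N = 0 ∨ ∃ x < N, foldUpTo max g N = g x) := by
  induction N with
  | zero => simp [foldUpTo]
  | succ N ih =>
    obtain ⟨h1, h2, h3⟩ := ih
    simp only [foldUpTo]
    refine ⟨fun x hx => ?_, le_max_of_le_left h2, ?_⟩
    · rcases Nat.lt_succ_iff_lt_or_eq.1 hx with hx | rfl
      · exact (h1 x hx).trans (le_max_left _ _)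
      · exact le_max_right _ _
    · rcases max_choice (foldUpTo max g N) (g N) with h | h
      · rw [h]
        exact h3.imp id fun ⟨x, hx, e⟩ => ⟨x, by omega, e⟩
      · exact .inr ⟨N, by omega, h⟩

/-! The terms of the filter. The arrays are: `0` holds `ε`, `1` the points, `2` the weighted mean,
`5` the weights, `6` the scatter matrix, `7` its power, `8` the scores, `9` the largest score,
`10` the threshold, `11` the proposed weights. -/

/-- Coordinate of the weighted mean. -/
noncomputable def meanTerm (s : Store) : ℝ :=
  (∑ x ∈ Finset.range (s.index 1), s.real 5 x (s.index 2) * s.real 1 x (s.index 7)) /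
    ∑ x ∈ Finset.range (s.index 1), s.real 5 x (s.index 2)

/-- Entry of the scatter matrix. -/
noncomputable def scatterTerm (s : Store) : ℝ :=
  ∑ x ∈ Finset.range (s.index 1), s.real 5 x (s.index 2) *
    ((s.real 1 x (s.index 6) - s.real 2 (s.index 2) (s.index 6)) *
      (s.real 1 x (s.index 7) - s.real 2 (s.index 2) (s.index 7)))

/-- Entry of the identity matrix. -/
noncomputable def identityTerm (s : Store) : ℝ :=
  if (s.index 6 : ℝ) ≤ s.index 7 then if (s.index 7 : ℝ) ≤ s.index 6 then ((1 : ℚ) : ℝ)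
    else ((0 : ℚ) : ℝ) else ((0 : ℚ) : ℝ)

/-- Entry of a matrix product. -/
noncomputable def productTerm (s : Store) : ℝ :=
  ∑ x ∈ Finset.range (s.index 0), s.real 7 (s.index 6) x * s.real 6 x (s.index 7)

/-- Inner product of a row of the matrix in array `7` with a centred point. -/
noncomputable def projectionTerm (s : Store) : ℝ :=
  ∑ x ∈ Finset.range (s.index 0), s.real 7 (s.index 8) x *
    (s.real 1 (s.index 6) x - s.real 2 (s.index 2) x)

/-- Score of a point. -/
noncomputable def scoreTerm (s : Store) : ℝ :=
  if s.real 5 (s.index 6) (s.index 2) ≤ ((0 : ℚ) : ℝ) then ((0 : ℚ) : ℝ) else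
    ∑ x ∈ Finset.range (s.index 0),
      projectionTerm (s.setIndex 8 x) * projectionTerm (s.setIndex 8 x)

/-- The largest score. -/
noncomputable def topTerm (s : Store) : ℝ :=
  foldUpTo max (fun x => s.real 8 x (s.index 2)) (s.index 1)

/-- Total weight of the points with larger score than the point with index in register `8`. -/
noncomputable def massTerm (s : Store) : ℝ :=
  ∑ x ∈ Finset.range (s.index 1),
    if s.real 8 x (s.index 2) ≤ s.real 8 (s.index 8) (s.index 2) then ((0 : ℚ) : ℝ)
      else s.real 5 x (s.index 2)

/-- The difference between the largest score and the threshold score. -/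
noncomputable def gapTerm (s : Store) : ℝ :=
  if massTerm s ≤ ((2 : ℚ) : ℝ) * s.real 0 (s.index 2) (s.index 2) * s.index 1 then
    s.real 9 (s.index 2) (s.index 2) - s.real 8 (s.index 8) (s.index 2) else ((0 : ℚ) : ℝ)

/-- The threshold. -/
noncomputable def thresholdTerm (s : Store) : ℝ :=
  s.real 9 (s.index 2) (s.index 2) - foldUpTo max (fun x => gapTerm (s.setIndex 8 x)) (s.index 1)

/-- The proposed weight. -/
noncomputable def proposalTerm (s : Store) : ℝ :=
  if s.real 8 (s.index 6) (s.index 2) ≤ s.real 10 (s.index 2) (s.index 2) then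
    s.real 5 (s.index 6) (s.index 2) else
    s.real 5 (s.index 6) (s.index 2) * (((1 : ℚ) : ℝ) - s.real 8 (s.index 6) (s.index 2) /
      s.real 9 (s.index 2) (s.index 2))

/-- The next weight. -/
noncomputable def weightTerm (s : Store) : ℝ :=
  if ((1 : ℚ) : ℝ) ≤ s.real 0 (s.index 2) (s.index 2) * s.index 1 then
    if (((1 : ℚ) : ℝ) - ((2 : ℚ) : ℝ) * s.real 0 (s.index 2) (s.index 2)) * s.index 1 ≤
        ∑ x ∈ Finset.range (s.index 1), s.real 11 x (s.index 2) then
      s.real 11 (s.index 6) (s.index 2) else s.real 5 (s.index 6) (s.index 2)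
  else s.real 5 (s.index 6) (s.index 2)

theorem evaluable_entry {L a i j : ℕ} (h : a ≠ 3 ∧ a ≠ 4 ∧ i < L ∧ (i < 3 ∨ 6 ≤ i) ∧ j < L ∧
    (j < 3 ∨ 6 ≤ j) := by decide) : Evaluable L fun s => s.real a (s.index i) (s.index j) :=
  .entry h.1 h.2.1 h.2.2.1 h.2.2.2.1 h.2.2.2.2.1 h.2.2.2.2.2

theorem evaluable_index {L k : ℕ} (h : k < L ∧ (k < 3 ∨ 6 ≤ k) := by decide) :
    Evaluable L fun s => (s.index k : ℝ) :=
  .ofIndex h.1 h.2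

theorem evaluable_meanTerm : Evaluable 8 meanTerm :=
  (Evaluable.div (by omega)
    (.sum (by omega) .size (.mul (by omega) (evaluable_entry (L := 9) (a := 5) (i := 8) (j := 2))
      (evaluable_entry (a := 1) (i := 8) (j := 7))))
    (.sum (by omega) .size
      (evaluable_entry (L := 9) (a := 5) (i := 8) (j := 2)))).of_eq fun _ => rfl

theorem evaluable_scatterTerm : Evaluable 8 scatterTerm :=
  (Evaluable.sum (by omega) .size (.mul (by omega)
    (evaluable_entry (L := 9) (a := 5) (i := 8) (j := 2)) (.mul (by omega)
    (.sub (by omega) (evaluable_entry (a := 1) (i := 8) (j := 6))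
      (evaluable_entry (a := 2) (i := 2) (j := 6)))
    (.sub (by omega) (evaluable_entry (a := 1) (i := 8) (j := 7))
      (evaluable_entry (a := 2) (i := 2) (j := 7)))))).of_eq fun _ => rfl

theorem evaluable_identityTerm : Evaluable 8 identityTerm :=
  .ite (by omega) evaluable_index evaluable_index
    (.ite (by omega) evaluable_index evaluable_index (.const 8 1) (.const 8 0)) (.const 8 0)

theorem evaluable_productTerm : Evaluable 8 productTerm :=
  (Evaluable.sum (by omega) .dim (.mul (by omega)
    (evaluable_entry (L := 9) (a := 7) (i := 6) (j := 8))
    (evaluable_entry (a := 6) (i := 8) (j := 7)))).of_eq fun _ => rfl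

theorem evaluable_projectionTerm : Evaluable 9 projectionTerm :=
  (Evaluable.sum (by omega) .dim (.mul (by omega)
    (evaluable_entry (L := 10) (a := 7) (i := 8) (j := 9))
    (.sub (by omega) (evaluable_entry (a := 1) (i := 6) (j := 9))
      (evaluable_entry (a := 2) (i := 2) (j := 9))))).of_eq fun _ => rfl

theorem evaluable_scoreTerm : Evaluable 8 scoreTerm :=
  .ite (by omega) evaluable_entry (.const 8 0) (.const 8 0)
    (.sum (by omega) .dim (.mul (by omega) evaluable_projectionTerm evaluable_projectionTerm))

theorem evaluable_topTerm : Evaluable 8 topTerm :=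
  (Evaluable.max (by omega) .size
    (evaluable_entry (L := 9) (a := 8) (i := 8) (j := 2))).of_eq fun _ => rfl

theorem evaluable_massTerm : Evaluable 9 massTerm :=
  (Evaluable.sum (by omega) .size (.ite (by omega)
    (evaluable_entry (L := 10) (a := 8) (i := 9) (j := 2))
    (evaluable_entry (a := 8) (i := 8) (j := 2)) (.const 10 0)
    (evaluable_entry (a := 5) (i := 9) (j := 2)))).of_eq fun _ => rfl

theorem evaluable_gapTerm : Evaluable 9 gapTerm :=
  .ite (by omega) evaluable_massTerm
    (.mul (by omega) (.mul (by omega) (.const 9 2) evaluable_entry) evaluable_index)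
    (.sub (by omega) evaluable_entry evaluable_entry) (.const 9 0)

theorem evaluable_thresholdTerm : Evaluable 8 thresholdTerm :=
  .sub (by omega) evaluable_entry (.max (by omega) .size evaluable_gapTerm)

theorem evaluable_proposalTerm : Evaluable 8 proposalTerm :=
  .ite (by omega) evaluable_entry evaluable_entry evaluable_entry
    (.mul (by omega) evaluable_entry
      (.sub (by omega) (.const 8 1) (.div (by omega) evaluable_entry evaluable_entry)))

theorem evaluable_weightTerm : Evaluable 8 weightTerm :=
  .ite (by omega) (.const 8 1) (.mul (by omega) evaluable_entry evaluable_index)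
    (.ite (by omega) (.mul (by omega) (.sub (by omega) (.const 8 1)
      (.mul (by omega) (.const 8 2) evaluable_entry)) evaluable_index)
      ((Evaluable.sum (by omega) .size
        (evaluable_entry (L := 9) (a := 11) (i := 8) (j := 2))).of_eq fun _ => rfl)
      evaluable_entry evaluable_entry) evaluable_entry

/-- Computation of the power of the scatter matrix. -/
noncomputable def powerStep (d n : ℕ) (A : Arrays) : Arrays :=
  (fun A => (assign 7 .dim .dim productTerm d n)^[d] A)^[n]
    (assign 7 .dim .dim identityTerm d n A)

theorem implementable_assign {T : Store → ℝ} (a : ℕ) (b₁ b₂ : Bound) (hT : Evaluable 8 T)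
    (h : a ≠ 3 ∧ a ≠ 4 := by decide) : Implementable 6 (assign a b₁ b₂ T) :=
  hT.assign h.1 h.2 b₁ b₂

/-- The product d n is not a `Bound`, so the exponent is reached by nested loops, with counters in
registers 4 and 5. -/
theorem implementable_powerStep : Implementable 4 powerStep := by
  have h := Implementable.seq (c := 4) (by omega)
    ((implementable_assign 7 .dim .dim evaluable_identityTerm).mono (by omega))
    (Implementable.iterate (by omega) .size (Implementable.iterate (by omega) .dim
      (implementable_assign 7 .dim .dim evaluable_productTerm)))
  exact h

/-- One round of the filter on arrays. -/
noncomputable def roundStep (d n : ℕ) (A : Arrays) : Arrays :=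
  let A := assign 2 .one .dim meanTerm d n A
  let A := assign 6 .dim .dim scatterTerm d n A
  let A := powerStep d n A
  let A := assign 8 .size .one scoreTerm d n A
  let A := assign 9 .one .one topTerm d n A
  let A := assign 10 .one .one thresholdTerm d n A
  let A := assign 11 .size .one proposalTerm d n A
  assign 5 .size .one weightTerm d n A

theorem implementable_roundStep : Implementable 4 roundStep := by
  have h1 := (implementable_assign 2 .one .dim evaluable_meanTerm).seq (by omega)
    (implementable_assign 6 .dim .dim evaluable_scatterTerm)
  have h2 := (h1.mono (by omega)).seq (by omega) implementable_powerStep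
  have h3 := (((implementable_assign 8 .size .one evaluable_scoreTerm).seq (by omega)
    (implementable_assign 9 .one .one evaluable_topTerm)).seq (by omega)
    (implementable_assign 10 .one .one evaluable_thresholdTerm)).seq (by omega)
    ((implementable_assign 11 .size .one evaluable_proposalTerm).seq (by omega)
    (implementable_assign 5 .size .one evaluable_weightTerm))
  have h := h2.seq (by omega) (h3.mono (by omega))
  exact h

/-- The whole algorithm on arrays. -/
noncomputable def filterStep (d n : ℕ) (A : Arrays) : Arrays :=
  assign 2 .one .dim meanTerm d n
    ((roundStep d n)^[n] (assign 5 .size .one (fun _ => ((1 : ℚ) : ℝ)) d n A))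

theorem implementable_filterStep : Implementable 3 filterStep := by
  have h := Implementable.seq (c := 3) (by omega) (Implementable.seq (by omega)
    ((implementable_assign 5 .size .one (.const 8 1)).mono (by omega))
    (Implementable.iterate (by omega) .size implementable_roundStep))
    ((implementable_assign 2 .one .dim evaluable_meanTerm).mono (by omega))
  exact h

end RealRAM

/-! ### The program computes the filter -/

namespace RealRAM

variable {d n : ℕ} {ε : ℝ} {y : Fin n → EuclideanSpace ℝ (Fin d)} {w : Fin n → ℝ} {A : Arrays}

theorem assign_of_ne {a a' : ℕ} (h : a' ≠ a) (b₁ b₂ : Bound) (T : Store → ℝ) (d n : ℕ)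
    (A : Arrays) : assign a b₁ b₂ T d n A a' = A a' :=
  Function.update_of_ne h _ _

theorem assign_self {a i j : ℕ} {b₁ b₂ : Bound} (hi : i < b₁.val d n) (hj : j < b₂.val d n)
    (T : Store → ℝ) (A : Arrays) : assign a b₁ b₂ T d n A a i j = T (at₂ d n i j A) := by
  rw [assign, Function.update_self, if_pos ⟨hi, hj⟩]

/-- The matrix stored in an array. -/
def matrixAt (d : ℕ) (A : Arrays) (a : ℕ) : Matrix (Fin d) (Fin d) ℝ := of fun i j => A a i j

theorem matrixAt_identity (A : Arrays) :
    matrixAt d (assign 7 .dim .dim identityTerm d n A) 7 = 1 := by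
  ext i j
  rw [matrixAt, of_apply, assign_self i.2 j.2, one_apply]
  simp only [identityTerm, at₂, Nat.cast_le, Fin.ext_iff]
  norm_num
  split_ifs <;> first | rfl | omega

theorem matrixAt_product (A : Arrays) :
    matrixAt d (assign 7 .dim .dim productTerm d n A) 7 = matrixAt d A 7 * matrixAt d A 6 := by
  ext i j
  rw [matrixAt, of_apply, assign_self i.2 j.2, mul_apply]
  simp [productTerm, at₂, Finset.sum_range, matrixAt]

theorem powerStep_spec (d n : ℕ) (A : Arrays) :
    (∀ a, a ≠ 7 → powerStep d n A a = A a) ∧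
      matrixAt d (powerStep d n A) 7 = matrixAt d A 6 ^ (d * n) := by
  have h : ∀ k, (∀ a, a ≠ 7 → (assign 7 .dim .dim productTerm d n)^[k]
        (assign 7 .dim .dim identityTerm d n A) a = A a) ∧
      matrixAt d ((assign 7 .dim .dim productTerm d n)^[k]
        (assign 7 .dim .dim identityTerm d n A)) 7 = matrixAt d A 6 ^ k := by
    intro k
    induction k with
    | zero => exact ⟨fun a ha => assign_of_ne ha _ _ _ _ _ _, by
        rw [Function.iterate_zero, id, matrixAt_identity, pow_zero]⟩
    | succ k ih =>
      rw [Function.iterate_succ_apply']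
      refine ⟨fun a ha => by rw [assign_of_ne ha, ih.1 a ha], ?_⟩
      rw [matrixAt_product, ih.2, pow_succ]
      congr 1
      ext i j
      simp only [matrixAt, of_apply, ih.1 6 (by omega)]
  have := h (d * n)
  rwa [Function.iterate_mul] at this

/-- The arrays hold `ε`, the points `y` and the weights `w`. -/
structure Holds (ε : ℝ) (y : Fin n → EuclideanSpace ℝ (Fin d)) (w : Fin n → ℝ)
    (A : Arrays) : Prop where
  eps : A 0 0 0 = ε
  points : ∀ (i : Fin n) (j : Fin d), A 1 i j = y i j
  weights : ∀ i : Fin n, A 5 i 0 = w i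

theorem Holds.mean (h : Holds ε y w A) (j : Fin d) :
    assign 2 .one .dim meanTerm d n A 2 0 j = weightedMean w y j := by
  rw [assign_self (by simp [Bound.val]) j.2]
  simp [meanTerm, at₂, Finset.sum_range, h.weights, h.points, weightedMean, div_eq_inv_mul]

theorem Holds.round (h : Holds ε y w A) :
    ∃ w', IsRound ε y w w' ∧ Holds ε y w' (roundStep d n A) := by
  set A₁ := assign 2 .one .dim meanTerm d n A with hA₁
  set A₂ := assign 6 .dim .dim scatterTerm d n A₁ with hA₂
  set A₃ := powerStep d n A₂ with hA₃
  set A₄ := assign 8 .size .one scoreTerm d n A₃ with hA₄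
  set A₅ := assign 9 .one .one topTerm d n A₄ with hA₅
  set A₆ := assign 10 .one .one thresholdTerm d n A₅ with hA₆
  set A₇ := assign 11 .size .one proposalTerm d n A₆ with hA₇
  have hA₈ : roundStep d n A = assign 5 .size .one weightTerm d n A₇ := rfl
  set μ := weightedMean w y with hμ
  have one : 0 < Bound.one.val d n := Nat.one_pos
  -- values in the successive stores
  have f1 : ∀ a, a ≠ 2 → A₁ a = A a := fun a ha => assign_of_ne ha _ _ _ _ _ _
  have f2 : ∀ a, a ≠ 6 → A₂ a = A₁ a := fun a ha => assign_of_ne ha _ _ _ _ _ _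
  have f3 : ∀ a, a ≠ 7 → A₃ a = A₂ a := fun a ha => (powerStep_spec d n A₂).1 a ha
  have f4 : ∀ a, a ≠ 8 → A₄ a = A₃ a := fun a ha => assign_of_ne ha _ _ _ _ _ _
  have f5 : ∀ a, a ≠ 9 → A₅ a = A₄ a := fun a ha => assign_of_ne ha _ _ _ _ _ _
  have f6 : ∀ a, a ≠ 10 → A₆ a = A₅ a := fun a ha => assign_of_ne ha _ _ _ _ _ _
  have f7 : ∀ a, a ≠ 11 → A₇ a = A₆ a := fun a ha => assign_of_ne ha _ _ _ _ _ _
  have v1 : ∀ j : Fin d, A₁ 2 0 j = μ j := h.mean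
  have v2 : matrixAt d A₂ 6 = scatter w y := by
    ext a b
    rw [matrixAt, of_apply, hA₂, assign_self a.2 b.2]
    simp [scatterTerm, at₂, Finset.sum_range, f1 5, f1 1, v1, h.weights, h.points, scatter, hμ]
  have v3 : ∀ i j : Fin d, A₃ 7 i j = (scatter w y ^ (d * n)) i j := by
    have := (powerStep_spec d n A₂).2
    rw [v2] at this
    intro i j
    rw [← this]
    rfl
  let f : Fin n → ℝ := fun i => A₄ 8 i 0
  let F := A₅ 9 0 0
  let T := A₆ 10 0 0
  let v : Fin n → ℝ := fun i => A₇ 11 i 0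
  let w' : Fin n → ℝ := fun i => roundStep d n A 5 i 0
  have hf : ∀ i, f i = if w i ≤ 0 then 0 else
      rawScore (rowVectors (scatter w y ^ (d * n))) w y i := by
    intro i
    change A₄ 8 i 0 = _
    rw [hA₄, assign_self i.2 one]
    have e : ∀ l : Fin d, inner ℝ (rowVectors (scatter w y ^ (d * n)) l) (y i - μ) =
        ∑ x : Fin d, A₃ 7 l x * (A₃ 1 i x - A₃ 2 0 x) := by
      intro l
      rw [rowVectors, inner_toLp]
      refine Finset.sum_congr rfl fun x _ => ?_
      rw [v3, f3 1 (by omega), f2 1 (by omega), f1 1 (by omega), h.points, f3 2 (by omega),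
        f2 2 (by omega), v1, PiLp.sub_apply]
    simp only [rawScore, ← hμ, e]
    simp [scoreTerm, projectionTerm, at₂, Finset.sum_range, f3 5, f2 5, f1 5, h.weights, sq]
  have hF : F = foldUpTo max (fun x => A₄ 8 x 0) n := assign_self one one _ _
  have hmass : ∀ j : Fin n, massTerm ((at₂ d n 0 0 A₅).setIndex 8 j) =
      ∑ i, if f i ≤ f j then 0 else w i := by
    intro j
    simp [massTerm, at₂, Finset.sum_range, f5 8, f5 5, f4 5, f3 5, f2 5, f1 5, h.weights, f]
  have hgap : ∀ j : Fin n, gapTerm ((at₂ d n 0 0 A₅).setIndex 8 j) =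
      if ∑ i, (if f i ≤ f j then 0 else w i) ≤ 2 * ε * n then F - f j else 0 := by
    intro j
    rw [gapTerm, hmass]
    simp [at₂, f5 8, f5 0, f4 0, f3 0, f2 0, f1 0, h.eps, f, F]
  have hT : T = F - foldUpTo max (fun x => gapTerm ((at₂ d n 0 0 A₅).setIndex 8 x)) n :=
    assign_self one one _ _
  obtain ⟨t1, t2, t3⟩ := foldUpTo_max (fun x => A₄ 8 x 0) n
  obtain ⟨g1, g2, g3⟩ := foldUpTo_max (fun x => gapTerm ((at₂ d n 0 0 A₅).setIndex 8 x)) n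
  rw [← hF] at t1 t2 t3
  refine ⟨w', ⟨f, v, F, T, hf, fun i => t1 i i.2, t2, ?_, ?_, ?_, ?_, ?_⟩, ?_, ?_, fun i => rfl⟩
  · exact t3.imp id fun ⟨x, hx, e⟩ => ⟨⟨x, hx⟩, e⟩
  -- The least admissible score is obtained from a maximum, as F minus the largest gap F - f j.
  -- Inadmissible j contribute gap 0, that is, the default T = F.
  · rcases g3 with e | ⟨x, hx, e⟩
    · left
      rw [hT, e, sub_zero]
    · have := hgap ⟨x, hx⟩
      rw [hT, e, this]
      split_ifs with hc
      · exact .inr ⟨⟨x, hx⟩, by ring, hc⟩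
      · exact .inl (sub_zero _)
  · intro j hj
    have h1 := g1 j j.2
    simp only [hgap j, if_pos hj] at h1
    rw [hT]
    linarith
  · intro i
    change A₇ 11 i 0 = _
    rw [hA₇, assign_self i.2 one]
    simp [proposalTerm, at₂, f6 8, f5 8, f6 9, f6 5, f5 5, f4 5, f3 5, f2 5, f1 5, h.weights, f, F,
      T]
  · intro i
    change roundStep d n A 5 i 0 = _
    rw [hA₈, assign_self i.2 one]
    simp [weightTerm, at₂, Finset.sum_range, f7 0, f6 0, f5 0, f4 0, f3 0, f2 0, f1 0, h.eps, f7 5,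
      f6 5, f5 5, f4 5, f3 5, f2 5, f1 5, h.weights, v]
  · rw [hA₈, assign_of_ne (by omega), f7 0 (by omega), f6 0 (by omega), f5 0 (by omega),
      f4 0 (by omega), f3 0 (by omega), f2 0 (by omega), f1 0 (by omega), h.eps]
  · intro i j
    rw [hA₈, assign_of_ne (by omega), f7 1 (by omega), f6 1 (by omega), f5 1 (by omega),
      f4 1 (by omega), f3 1 (by omega), f2 1 (by omega), f1 1 (by omega), h.points]

/-- The result of the algorithm: the weighted mean for weights obtained from constant weights by
`n` rounds. -/
theorem filterStep_spec (hA : A 0 0 0 = ε) (hy : ∀ (i : Fin n) (j : Fin d), A 1 i j = y i j) :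
    ∃ u : ℕ → Fin n → ℝ, (u 0 = fun _ => 1) ∧ (∀ k, IsRound ε y (u k) (u (k + 1))) ∧
      ∀ j : Fin d, filterStep d n A 2 0 j = weightedMean (u n) y j := by
  have h0 : Holds ε y (fun _ => 1) (assign 5 .size .one (fun _ => ((1 : ℚ) : ℝ)) d n A) := by
    refine ⟨?_, fun i j => ?_, fun i => ?_⟩
    · rw [assign_of_ne (by omega), hA]
    · rw [assign_of_ne (by omega), hy]
    · rw [assign_self i.2 Nat.one_pos, Rat.cast_one]
  -- The next weights depend on weights and arrays together, so pairs are iterated to get one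
  -- sequence in step with the machine.
  choose! next hround hholds using
    fun (p : (Fin n → ℝ) × Arrays) (hp : Holds ε y p.1 p.2) => hp.round
  let state : ℕ → (Fin n → ℝ) × Arrays := fun k =>
    (fun p => (next p, roundStep d n p.2))^[k]
      (fun _ => 1, assign 5 .size .one (fun _ => ((1 : ℚ) : ℝ)) d n A)
  have hsucc : ∀ k, state (k + 1) = (next (state k), roundStep d n (state k).2) := fun k =>
    Function.iterate_succ_apply' _ _ _
  have hstate : ∀ k, Holds ε y (state k).1 (state k).2 ∧
      (state k).2 = (roundStep d n)^[k]
        (assign 5 .size .one (fun _ => ((1 : ℚ) : ℝ)) d n A) := by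
    intro k
    induction k with
    | zero => exact ⟨h0, rfl⟩
    | succ k ih =>
      rw [hsucc, Function.iterate_succ_apply', ← ih.2]
      exact ⟨hholds _ ih.1, rfl⟩
  refine ⟨fun k => (state k).1, rfl, fun k => ?_, fun j => ?_⟩
  · beta_reduce
    rw [hsucc]
    exact hround _ (hstate k).1
  · rw [filterStep, ← (hstate n).2]
    exact (hstate n).1.mean j

end RealRAM

/-! ### Conclusion -/

theorem IsRound.eq_of_lt {d n : ℕ} {ε : ℝ} {y : Fin n → EuclideanSpace ℝ (Fin d)}
    {w w' : Fin n → ℝ} (h : IsRound ε y w w') (hε : ε * n < 1) : w' = w := by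
  obtain ⟨f, v, F, T, -, -, -, -, -, -, -, hw⟩ := h
  funext i
  rw [hw, if_neg (not_le.2 hε)]

/-- If εn < 1, no point has been replaced and the weights stay 1, so stability of the plain mean
suffices. Otherwise the invariant applies with 3εD = δ², and 5679 ≤ 76². -/
theorem norm_weightedMean_sub_le {d n : ℕ} {ε δ : ℝ} {y : Fin n → EuclideanSpace ℝ (Fin d)}
    {u : ℕ → Fin n → ℝ} (hu0 : u 0 = fun _ => 1) (hu : ∀ k, IsRound ε y (u k) (u (k + 1)))
    {X : Measure (EuclideanSpace ℝ (Fin d))} {x : Fin n → EuclideanSpace ℝ (Fin d)} (hn : 0 < n)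
    (hx : IsStable (3 * ε) δ X x) (hxy : IsCorruption ε x y) :
    ‖weightedMean (u n) y - distMean X‖ ≤ 76 * δ := by
  classical
  have hε : 0 < ε := by linarith [hx.eps_pos]
  have hε' : ε < 1 / 6 := by linarith [hx.eps_lt_half]
  have hδ : 0 ≤ δ := by linarith [hx.eps_le_delta]
  have hn' : (0 : ℝ) < n := by exact_mod_cast hn
  rcases Nat.eq_zero_or_pos d with rfl | hd
  · rw [Subsingleton.elim (weightedMean (u n) y - distMean X) 0, norm_zero]
    positivity
  obtain ⟨σ, hσ⟩ := hxy
  set G : Finset (Fin n) := Finset.univ.filter fun i => y i = x (σ i) with hG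
  have hB : (Gᶜ.card : ℝ) ≤ ε * n := by
    rw [hG, Finset.compl_filter]
    convert hσ
  rcases lt_or_ge (ε * n) 1 with hεn | hεn
  · have hall : ∀ i, y i = x (σ i) := by
      have : Gᶜ = ∅ := by
        rw [← Finset.card_eq_zero]
        have : (Gᶜ.card : ℝ) < 1 := hB.trans_lt hεn
        exact_mod_cast Nat.lt_one_iff.1 (by exact_mod_cast this)
      intro i
      by_contra hi
      have : i ∈ Gᶜ := by simp [hG, hi]
      simp_all
    have hconst : ∀ k, u k = fun _ => 1 := by
      intro k
      induction k with
      | zero => exact hu0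
      | succ k ih => rw [(hu k).eq_of_lt hεn, ih]
    set r := weightedMean (u n) y - distMean X with hr
    have h1 := inner_weightedMean_sub (u n) y (by simp [hconst, hn.ne']) (distMean X) r
    rw [← hr, real_inner_self_eq_norm_sq] at h1
    simp only [hconst, one_mul, hall, Finset.sum_const, Finset.card_univ, Fintype.card_fin,
      nsmul_eq_mul, mul_one] at h1
    rw [Equiv.sum_comp σ fun i => inner ℝ r (x i - distMean X)] at h1
    have h2 := (le_abs_self _).trans (hx.sum_le hn r)
    rw [← h1] at h2
    rcases (norm_nonneg r).eq_or_lt with h0 | h0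
    · rw [← h0]
      positivity
    · have : ‖r‖ * (n * ‖r‖) ≤ δ * (n * ‖r‖) := by linarith
      have := le_of_mul_le_mul_right this (by positivity)
      linarith
  · set D := δ ^ 2 / (3 * ε) with hD
    have h3ε : 0 < 3 * ε := by linarith
    have hDε : 3 * ε ≤ D := by
      rw [hD, le_div_iff₀ h3ε]
      nlinarith [hx.eps_le_delta]
    have hεD : 3 * ε * D = δ ^ 2 := mul_div_cancel₀ _ h3ε.ne'
    have hclean : ∀ r : EuclideanSpace ℝ (Fin d),
        Clean ε D (‖r‖ ^ 2) fun i => inner ℝ r (x (σ i) - distMean X) := fun r =>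
      (hx.clean hn hεn r).comp_perm σ
    have hGe : ∀ i ∈ G, y i = x (σ i) := fun i hi => by simpa [hG] using hi
    have hinv : ∀ k, RoundInvariant ε D G y k (u k) := by
      intro k
      induction k with
      | zero =>
        rw [hu0]
        refine ⟨fun _ => zero_le_one, fun _ => le_rfl, ?_, .inr (by simp)⟩
        simp only [Finset.sum_const, Finset.card_univ, Fintype.card_fin, nsmul_eq_mul, mul_one]
        nlinarith
      | succ k ih =>
        exact (hu k).invariant hd hn hε hε' hDε hεn hclean hGe hB ih
    have key := (hinv n).norm_sub_le hn hε hε' hDε hclean hGe hB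
    rw [hεD] at key
    refine abs_le_of_sq_le_sq' (by nlinarith) (by positivity) |>.2

theorem theorem2 :
    ∃ (P : RealRAM.Program) (p : Polynomial ℕ) (C : ℝ),
      ∀ (d n : ℕ) (ε : ℝ) (y : Fin n → EuclideanSpace ℝ (Fin d)),
        ∃ (t : ℕ) (s : RealRAM.Store),
          RealRAM.Exec P (RealRAM.input ε y) t s ∧ t ≤ p.eval (n + d) ∧
          ∀ (δ : ℝ) (X : Measure (EuclideanSpace ℝ (Fin d))) [IsProbabilityMeasure X]
            (x : Fin n → EuclideanSpace ℝ (Fin d)),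
            0 < n → Integrable (fun z => z) X → IsStable (3 * ε) δ X x → IsCorruption ε x y →
              ‖RealRAM.output d s - distMean X‖ ≤ C * δ := by
  obtain ⟨P, p, hP⟩ := RealRAM.implementable_filterStep.exec
  refine ⟨P, p, 76, fun d n ε y => ?_⟩
  obtain ⟨t, s, hexec, ht, -, hs⟩ := hP (RealRAM.input ε y) rfl
  have h0 : (RealRAM.input ε y).index 0 = d := rfl
  have h1 : (RealRAM.input ε y).index 1 = n := rfl
  rw [h0, h1] at ht hs
  refine ⟨t, s, hexec, by rwa [add_comm], fun δ X _ x hn _ hx hxy => ?_⟩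
  obtain ⟨u, hu0, hu, hout⟩ := RealRAM.filterStep_spec (A := (RealRAM.input ε y).real) (ε := ε)
    (y := y) (by simp [RealRAM.input]) (fun i j => by simp [RealRAM.input])
  have e : RealRAM.output d s = weightedMean (u n) y := by
    ext j
    rw [← hout j, ← hs 2 (by omega) (by omega)]
    rfl
  rw [e]
  exact norm_weightedMean_sub_le hu0 hu hn hx hxy
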